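/- Let $b\ge 2$ and let $(\bar\xi_{ij})_{1\le i,j\le b}$ be a.s. positive random variables. Let $\mathbb V$ be the vertex set of the rooted $b$-ary tree with root $v_0$ (every vertex has $b$ children). Colour the vertices randomly with the colours $\{1,\dots,b\}$, level by level: the root has an arbitrary (possibly random) colour, and given the colours of the vertices at distance at most $n$ from the root, the vertices at distance $n+1$ receive each of the $(b!)^{b^n}$ colourings in which siblings have different colours with equal probability. Write $c(v)$ for the colour of $v$. Let each edge $(u,v)$, where $u$ is the parent of $v$, carry a random label $\zeta_{uv}$ such that, conditionally on the colouring $c$, (i) $\zeta_{uv}$ has the law of $\bar\xi_{c(u)c(v)}$; (ii) for any finite collection of edges $(u_1,v_1),\dots,(u_m,v_m)$ with pairwise distinct parents $u_1,\dots,u_m$, the labels $\zeta_{u_1v_1},\dots,\zeta_{u_mv_m}$ are independent (labels of sibling edges may be dependent). For $v\in\mathbb V$ let $\zeta[v]$ be the product of the labels of the edges on the path from $v_0$ to $v$ (with $\zeta[v_0]=1$) and let $Y=\sum_{v\in\mathbb V}\zeta[v]\in[0,\infty]$. For $s\in[0,1]$ let $m(s)=(\mathbb E\,\bar\xi_{ij}^{\,s})_{i,j=1}^b$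 and let $\rho(s)$ be the largest real eigenvalue of $m(s)$, with $\rho(s)=\infty$ if some entry of $m(s)$ is infinite. Let $\lambda_1=\inf_{s\in[0,1]}\rho(s)$ and $\mathbb D=\{s\in\mathbb R:\mathbb E\,\bar\xi_{ij}^{\,s}<\infty\ \forall i,j\}$. (a) If $\lambda_1<1$, then $Y<\infty$ a.s. (b) If $\lambda_1>1$, and if $[0,1]\subseteq\mathbb D$, $0\in\operatorname{Int}(\mathbb D)$, and $\mathbb E|\log\bar\xi_{ij}|<\infty$ and $\mathbb E|\bar\xi_{ij}\log\bar\xi_{ij}|<\infty$ for all $i,j$, then $Y=\infty$ a.s. -/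

import Mathlib

open MeasureTheory ProbabilityTheory
open scoped ENNReal Nat

namespace ColouredTree

/-- Vertices of the rooted `b`-ary tree: the root is `[]` and the children of `u` are the vertices
`i :: u` with `i : Fin b`; the distance of `u` from the root is `u.length`.  The edge from `u` to
its child `i :: u` is represented by the pair `(u, i)`. -/
abbrev Vertex (b : ℕ) : Type := List (Fin b)

/-- A colouring of the vertices is proper if siblings have different colours. -/
def IsProper {b : ℕ} (g : Vertex b → Fin b) : Prop :=
  ∀ u : Vertex b, Function.Injective fun i : Fin b => g (i :: u)

/-- A random colouring, built level by level: the colour of the root is arbitrary, and given the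
colours of the levels `0, …, n`, each of the `(b !) ^ (b ^ n)` proper colourings of level `n + 1`
has the same probability. -/
structure IsUniformColouring {b : ℕ} {Ω : Type*} [MeasurableSpace Ω] (P : Measure Ω)
    (c : Ω → Vertex b → Fin b) : Prop where
  measurable : Measurable c
  proper : ∀ᵐ ω ∂P, IsProper (c ω)
  uniform : ∀ (n : ℕ) (g : Vertex b → Fin b), IsProper g →
    P {ω | ∀ v : Vertex b, v.length ≤ n + 1 → c ω v = g v} =
      P {ω | ∀ v : Vertex b, v.length ≤ n → c ω v = g v} / (((b !) ^ (b ^ n) : ℕ) : ℝ≥0∞)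

/-- Random edge labels on a randomly coloured tree; `ζ u i` is the label of the edge from `u` to
`i :: u`.  Conditionally on the colouring `c`, the label of an edge has the law of
`ξ (colour of the parent) (colour of the child)`, and the labels of any finite collection of edges
with distinct parents are independent (labels of edges with the same parent may be dependent). -/
structure IsEnvironment {b : ℕ} {Ω₀ Ω : Type*} [MeasurableSpace Ω₀] [MeasurableSpace Ω]
    (P₀ : Measure Ω₀) (ξ : Fin b → Fin b → Ω₀ → ℝ)
    (P : Measure Ω) (c : Ω → Vertex b → Fin b) (ζ : Vertex b → Fin b → Ω → ℝ) : Prop where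
  measurable : ∀ (u : Vertex b) (i : Fin b), Measurable (ζ u i)
  cond_law : ∀ (u : Vertex b) (i : Fin b) (B : Set ℝ), MeasurableSet B →
    P⟦ζ u i ⁻¹' B | MeasurableSpace.comap c inferInstance⟧ =ᵐ[P]
      fun ω => P₀.real (ξ (c ω u) (c ω (i :: u)) ⁻¹' B)
  cond_indep : ∀ (S : Finset (Vertex b)) (e : Vertex b → Fin b) (B : Vertex b → Set ℝ),
    (∀ u ∈ S, MeasurableSet (B u)) →
    P⟦⋂ u ∈ S, ζ u (e u) ⁻¹' B u | MeasurableSpace.comap c inferInstance⟧ =ᵐ[P]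
      fun ω => ∏ u ∈ S, (P⟦ζ u (e u) ⁻¹' B u | MeasurableSpace.comap c inferInstance⟧) ω

/-- The product of the labels along the path from the root to a vertex. -/
def pathProd {b : ℕ} {Ω : Type*} (ζ : Vertex b → Fin b → Ω → ℝ) (ω : Ω) : Vertex b → ℝ
  | [] => 1
  | i :: u => ζ u i ω * pathProd ζ ω u

/-- The sum, over all vertices, of the product of the labels along the path from the root
(the labels are positive almost surely). -/
noncomputable def totalSum {b : ℕ} {Ω : Type*} (ζ : Vertex b → Fin b → Ω → ℝ) (ω : Ω) : ℝ≥0∞ :=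
  ∑' v : Vertex b, ENNReal.ofReal (pathProd ζ ω v)

/-- The moment `E (ξ i j) ^ s`, possibly infinite. -/
noncomputable def moment {b : ℕ} {Ω₀ : Type*} [MeasurableSpace Ω₀] (P₀ : Measure Ω₀)
    (ξ : Fin b → Fin b → Ω₀ → ℝ) (s : ℝ) (i j : Fin b) : ℝ≥0∞ :=
  ∫⁻ ω, ENNReal.ofReal (ξ i j ω ^ s) ∂P₀

/-- The set of real `s` such that all moments of order `s` are finite. -/
def finiteMoments {b : ℕ} {Ω₀ : Type*} [MeasurableSpace Ω₀] (P₀ : Measure Ω₀)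
    (ξ : Fin b → Fin b → Ω₀ → ℝ) : Set ℝ :=
  {s | ∀ i j, moment P₀ ξ s i j < ∞}

/-- The largest (real) eigenvalue of a real square matrix. -/
noncomputable def largestEigenvalue {b : ℕ} (A : Matrix (Fin b) (Fin b) ℝ) : ℝ :=
  sSup {x : ℝ | Module.End.HasEigenvalue (Matrix.toLin' A) x}

open Classical in
/-- The largest eigenvalue of the matrix of the moments of order `s`, which is `∞` if an entry
of that matrix is infinite. -/
noncomputable def rho {b : ℕ} {Ω₀ : Type*} [MeasurableSpace Ω₀] (P₀ : Measure Ω₀)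
    (ξ : Fin b → Fin b → Ω₀ → ℝ) (s : ℝ) : ℝ≥0∞ :=
  if s ∈ finiteMoments P₀ ξ then
    ENNReal.ofReal (largestEigenvalue (Matrix.of fun i j => (moment P₀ ξ s i j).toReal))
  else ∞

/-- The infimum of `rho` over `[0, 1]`. -/
noncomputable def lambdaOne {b : ℕ} {Ω₀ : Type*} [MeasurableSpace Ω₀] (P₀ : Measure Ω₀)
    (ξ : Fin b → Fin b → Ω₀ → ℝ) : ℝ≥0∞ :=
  ⨅ s ∈ Set.Icc (0 : ℝ) 1, rho P₀ ξ s

/-- The regularity conditions. -/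
structure IsRegular {b : ℕ} {Ω₀ : Type*} [MeasurableSpace Ω₀] (P₀ : Measure Ω₀)
    (ξ : Fin b → Fin b → Ω₀ → ℝ) : Prop where
  Icc_subset : Set.Icc (0 : ℝ) 1 ⊆ finiteMoments P₀ ξ
  zero_mem_interior : (0 : ℝ) ∈ interior (finiteMoments P₀ ξ)
  integrable_log : ∀ i j, Integrable (fun ω => Real.log (ξ i j ω)) P₀
  integrable_mul_log : ∀ i j, Integrable (fun ω => ξ i j ω * Real.log (ξ i j ω)) P₀

end ColouredTree

/-!
Why the theorem is true.

Given the colours of the vertices up to some depth, the labels of edges with distinct parents are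
independent, and their laws depend only on the colours of the endpoints (`IsQuenched`).  Since every
vertex has exactly one child of each colour, sums over the vertices of a given level have conditional
means which are given by powers of the moment matrix `m(s)` and do not depend on the colouring
otherwise; in particular only the properness of the colouring matters.  It therefore suffices to
prove bounds which are uniform over deterministic proper colourings (`lintegral_le_of_isQuenched`).

If `ρ(s) < 1` for some `s ∈ [0, 1]`, then the powers `ζ[v] ^ s` have a finite total mean by the
Perron-Frobenius theorem (`exists_pos_eigenvector`), and a family of positive numbers with a finite
sum of powers of order `s ≤ 1` is summable (`ae_totalSum_lt_top`).

Now let `ρ > 1` on `[0, 1]`.  After a restriction to edges with labels in `[M⁻¹, M]`, for a large `M`,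
this is still true (`exists_truncation`), and the moment matrix becomes a differentiable function of
all real `s`.  Let `s` minimise its Perron eigenvalue over `[0, 1]`, and let `r > 1` be the minimum.
The derivative of the eigenvalue at `s` is nonpositive if `0 < s` and nonnegative if `s < 1`
(`exists_minimiser`).  By Chernoff bounds with the orders `s ± δ`, the sum of the label products to
the power `s` over blocks of `k` edges is then carried, up to an exponentially small proportion, by
good blocks: those with product at most `H = exp (ε k)` (if `0 < s`) and at least `H⁻¹` (if `s < 1`).
With the weight `ζ ^ s` for good blocks, the branching factor is about `r ^ k` and exceeds `2 H`,
while the weights are bounded by `H` as well as by `H ζ` (`exists_good_blocks`).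

To such weights the second moment method applies (`measure_sum_pathWeight_lt`).  Sibling edges may be
dependent, and jointly with further edges even the law of a pair of siblings is not determined;
therefore, in the product of the weights along two paths, the factor of the second path at each
common vertex is replaced by the bound `H` (`pairWeight`).  As the branching factor is `2 H`, the
second moment is still comparable with the square of the mean.  With blocks starting at all vertices
of level `m`, the pairs of paths which start at different vertices are uncorrelated, and hence the
relative variance is of the order of the reciprocal of the number of these vertices.  So, with a
probability close to one, the weights of the paths of `n` blocks below level `m` sum up to at least a
constant times `(2 H) ^ n`, whereas this sum is at most `H ^ n` times a random constant times the
sum of all `ζ[v]`.  Letting first `n` and then `m` tend to infinity gives the divergence.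
-/

namespace ColouredTree

/-! ### Paths in trees and their weights -/


section Words

variable {ι : Type*}

/-- The finite set of words of length `n` over a finite alphabet. -/
noncomputable def words (ι : Type*) [Finite ι] (n : ℕ) : Finset (List ι) :=
  (List.finite_length_eq ι n).toFinset

@[simp]
lemma mem_words [Finite ι] {n : ℕ} {q : List ι} : q ∈ words ι n ↔ q.length = n := by
  simp [words]

lemma words_zero [Finite ι] : words ι 0 = {[]} := by
  ext q; simp [List.length_eq_zero_iff]

lemma sum_words_succ [Fintype ι] {M : Type*} [AddCommMonoid M] (n : ℕ) (f : List ι → M) :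
    ∑ q ∈ words ι (n + 1), f q = ∑ q ∈ words ι n, ∑ i, f (i :: q) := by
  rw [← Finset.sum_product']
  symm
  refine Finset.sum_bij (fun p _ => p.2 :: p.1) ?_ ?_ ?_ ?_
  · simp
  · rintro ⟨q, i⟩ _ ⟨q', i'⟩ _ h
    simp only [List.cons.injEq] at h
    simp [h.1, h.2]
  · intro q hq
    cases q with
    | nil => simp at hq
    | cons i q => exact ⟨(q, i), by simpa using hq, rfl⟩
  · simp

lemma card_words [Fintype ι] (n : ℕ) : (words ι n).card = Fintype.card ι ^ n := by
  induction n with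
  | zero => simp [words_zero]
  | succ n ih =>
    rw [Finset.card_eq_sum_ones, sum_words_succ]
    simp [ih, pow_succ]

/-- The product of the weights `w` along the path which leads from the vertex `u` of the tree
`List ι` to its descendant `q ++ u`. -/
def pathWeight {M : Type*} [Mul M] [One M] (w : List ι → ι → M) : List ι → List ι → M
  | [], _ => 1
  | i :: q, u => w (q ++ u) i * pathWeight w q u

@[simp]
lemma pathWeight_nil {M : Type*} [Mul M] [One M] (w : List ι → ι → M) (u : List ι) :
    pathWeight w [] u = 1 := rfl

lemma pathWeight_cons {M : Type*} [Mul M] [One M] (w : List ι → ι → M) (i : ι) (q u : List ι) :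
    pathWeight w (i :: q) u = w (q ++ u) i * pathWeight w q u := rfl

lemma pathWeight_append {M : Type*} [CommMonoid M] (w : List ι → ι → M) (p q u : List ι) :
    pathWeight w (p ++ q) u = pathWeight w p (q ++ u) * pathWeight w q u := by
  induction p with
  | nil => simp
  | cons i p ih => simp [pathWeight_cons, ih, mul_assoc]

lemma pathProd_eq_pathWeight {b : ℕ} {Ω : Type*} (ζ : Vertex b → Fin b → Ω → ℝ) (ω : Ω)
    (v : Vertex b) : pathProd ζ ω v = pathWeight (fun u i => ζ u i ω) v [] := by
  induction v with
  | nil => rfl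
  | cons i v ih => simp [pathWeight_cons, pathProd, ih]

lemma pathWeight_mono {w w' : List ι → ι → ℝ≥0∞} (h : ∀ u i, w u i ≤ w' u i) (q u : List ι) :
    pathWeight w q u ≤ pathWeight w' q u := by
  induction q with
  | nil => simp
  | cons i q ih => exact mul_le_mul' (h _ _) ih

open Classical in
/-- The set of edges of the path from `u` to `q ++ u`; an edge is encoded by its upper endpoint and
the label of the child. -/
noncomputable def edges : List ι → List ι → Finset (List ι × ι)
  | [], _ => ∅
  | i :: q, u => insert (q ++ u, i) (edges q u)

lemma exists_of_mem_edges {q u : List ι} {e : List ι × ι} (he : e ∈ edges q u) :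
    ∃ p : List ι, p.length < q.length ∧ e.1 = p ++ u := by
  classical
  induction q with
  | nil => simp [edges] at he
  | cons i q ih =>
    simp only [edges, Finset.mem_insert] at he
    rcases he with rfl | he
    · exact ⟨q, by simp, rfl⟩
    · obtain ⟨p, hp, h⟩ := ih he
      exact ⟨p, by simp; omega, h⟩

lemma length_of_mem_edges {q u : List ι} {e : List ι × ι} (he : e ∈ edges q u) :
    u.length ≤ e.1.length ∧ e.1.length < q.length + u.length := by
  obtain ⟨p, hp, h⟩ := exists_of_mem_edges he
  simp [h]; omega

lemma edges_cons_notMem (i : ι) (q u : List ι) : (q ++ u, i) ∉ edges q u := by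
  intro h
  have := (length_of_mem_edges h).2
  simp at this

lemma injOn_fst_edges (q u : List ι) : Set.InjOn Prod.fst (edges q u : Set (List ι × ι)) := by
  classical
  induction q with
  | nil => simp [edges]
  | cons i q ih =>
    rw [edges, Finset.coe_insert, Set.injOn_insert (by simpa using edges_cons_notMem i q u)]
    refine ⟨ih, ?_⟩
    rintro ⟨e, he, h⟩
    have := (length_of_mem_edges he).2
    simp [h] at this

lemma pathWeight_eq_prod {M : Type*} [CommMonoid M] (w : List ι → ι → M) (q u : List ι) :
    pathWeight w q u = ∏ e ∈ edges q u, w e.1 e.2 := by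
  classical
  induction q with
  | nil => simp [edges]
  | cons i q ih =>
    rw [edges, Finset.prod_insert (edges_cons_notMem i q u), pathWeight_cons, ih]

/-- If `x` is invariant for the one-step operator up to the factor `t`, then it is invariant for the
`n`-step operator up to the factor `t ^ n`. -/
lemma sum_words_pathWeight [Fintype ι] {R : Type*} [CommSemiring R] {N : ℕ} {m : List ι → ι → R}
    {x : List ι → R} {t : R}
    (h : ∀ u, u.length < N → ∑ i, m u i * x (i :: u) = t * x u) (n : ℕ) {u : List ι}
    (hu : n + u.length ≤ N) :
    ∑ q ∈ words ι n, pathWeight m q u * x (q ++ u) = t ^ n * x u := by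
  induction n with
  | zero => simp [words_zero]
  | succ n ih =>
    rw [sum_words_succ]
    calc ∑ q ∈ words ι n, ∑ i, pathWeight m (i :: q) u * x (i :: q ++ u)
        = ∑ q ∈ words ι n, t * (pathWeight m q u * x (q ++ u)) := by
          refine Finset.sum_congr rfl fun q hq => ?_
          have hq' : (q ++ u).length < N := by simp at hq ⊢; omega
          rw [mul_left_comm, ← h _ hq', Finset.mul_sum]
          refine Finset.sum_congr rfl fun i _ => ?_
          rw [pathWeight_cons, List.cons_append]; ring
      _ = t ^ (n + 1) * x u := by
          rw [← Finset.mul_sum, ih (by omega)]; ring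

lemma sum_words_pathWeight_le [Fintype ι] {N : ℕ} {m : List ι → ι → ℝ≥0∞}
    {x : List ι → ℝ≥0∞} {t : ℝ≥0∞}
    (h : ∀ u, u.length < N → ∑ i, m u i * x (i :: u) ≤ t * x u) (n : ℕ) {u : List ι}
    (hu : n + u.length ≤ N) :
    ∑ q ∈ words ι n, pathWeight m q u * x (q ++ u) ≤ t ^ n * x u := by
  induction n with
  | zero => simp [words_zero]
  | succ n ih =>
    rw [sum_words_succ]
    calc ∑ q ∈ words ι n, ∑ i, pathWeight m (i :: q) u * x (i :: q ++ u)
        ≤ ∑ q ∈ words ι n, t * (pathWeight m q u * x (q ++ u)) := by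
          refine Finset.sum_le_sum fun q hq => ?_
          have hq' : (q ++ u).length < N := by simp at hq ⊢; omega
          rw [mul_left_comm]
          refine le_trans (le_of_eq ?_) (mul_le_mul_right (h _ hq') _)
          rw [Finset.mul_sum]
          refine Finset.sum_congr rfl fun i _ => ?_
          rw [pathWeight_cons, List.cons_append]; ring
      _ ≤ t ^ (n + 1) * x u := by
          rw [← Finset.mul_sum, pow_succ', mul_assoc]
          exact mul_le_mul_right (ih (by omega)) _

open Classical in
/-- A majorant for the product of the weights along two paths of the same length from `u` to
`q ++ u` and from `u'` to `q' ++ u'`, for weights bounded by `H`.  Where both paths leave the same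
vertex, the weight of the second path is replaced by `H`; thus at most one edge below each vertex
is used. -/
noncomputable def pairWeight (H : ℝ≥0∞) (w : List ι → ι → ℝ≥0∞) (u u' : List ι) :
    List ι → List ι → ℝ≥0∞
  | i :: q, i' :: q' =>
    (if q ++ u = q' ++ u' then H * w (q ++ u) i else w (q ++ u) i * w (q' ++ u') i')
      * pairWeight H w u u' q q'
  | _, _ => 1

lemma pathWeight_mul_le_pairWeight {H : ℝ≥0∞} {w : List ι → ι → ℝ≥0∞} (hw : ∀ u i, w u i ≤ H)
    (u u' : List ι) (q q' : List ι) (h : q.length = q'.length) :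
    pathWeight w q u * pathWeight w q' u' ≤ pairWeight H w u u' q q' := by
  induction q generalizing q' with
  | nil =>
    obtain rfl : q' = [] := by simpa [eq_comm, List.length_eq_zero_iff] using h
    simp [pairWeight]
  | cons i q ih =>
    cases q' with
    | nil => simp at h
    | cons i' q' =>
      rw [pathWeight_cons, pathWeight_cons, pairWeight, mul_mul_mul_comm]
      refine mul_le_mul' ?_ (ih q' (by simpa using h))
      split_ifs with he
      · rw [mul_comm]
        exact mul_le_mul_left (hw _ _) _
      · exact le_rfl

lemma pairWeight_self (H : ℝ≥0∞) (w : List ι → ι → ℝ≥0∞) (u q : List ι) :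
    pairWeight H w u u q q = H ^ q.length * pathWeight w q u := by
  induction q with
  | nil => simp [pairWeight]
  | cons i q ih =>
    simp only [pairWeight, if_true, ih, pathWeight_cons, List.length_cons]; ring

/-- `pairWeight` is a monomial in the weights of edges with distinct upper endpoints. -/
lemma exists_pairWeight_eq_prod (H : ℝ≥0∞) {u u' : List ι} (hu : u.length = u'.length)
    (q q' : List ι) (h : q.length = q'.length) :
    ∃ (c : ℕ) (E : Finset (List ι × ι)), Set.InjOn Prod.fst (E : Set (List ι × ι)) ∧
      (∀ e ∈ E, e.1.length < q.length + u.length) ∧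
      ∀ w : List ι → ι → ℝ≥0∞, pairWeight H w u u' q q' = H ^ c * ∏ e ∈ E, w e.1 e.2 := by
  classical
  induction q generalizing q' with
  | nil =>
    obtain rfl : q' = [] := by simpa [eq_comm, List.length_eq_zero_iff] using h
    exact ⟨0, ∅, by simp, by simp, by simp [pairWeight]⟩
  | cons i q ih =>
    cases q' with
    | nil => simp at h
    | cons i' q' =>
      have hl : q.length = q'.length := by simpa using h
      obtain ⟨c, E, hE, hlen, hp⟩ := ih q' hl
      have hnot : ∀ v j, v.length = q.length + u.length → v ∉ Prod.fst '' (E : Set (List ι × ι)) ∧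
          (v, j) ∉ E := by
        intro v j hv
        refine ⟨?_, fun hm => by have := hlen _ hm; simp [hv] at this⟩
        rintro ⟨e, he, rfl⟩
        have := hlen _ he
        omega
      by_cases he : q ++ u = q' ++ u'
      · have h1 := hnot (q ++ u) i (by simp)
        refine ⟨c + 1, insert (q ++ u, i) E, ?_, ?_, fun w => ?_⟩
        · rw [Finset.coe_insert, Set.injOn_insert (by simpa using h1.2)]
          exact ⟨hE, h1.1⟩
        · intro e hm
          rcases Finset.mem_insert.1 hm with rfl | hm
          · simp
          · have := hlen _ hm; simp; omega
        · rw [Finset.prod_insert h1.2, pairWeight, if_pos he, hp]; ring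
      · have h1 := hnot (q ++ u) i (by simp)
        have h2 := hnot (q' ++ u') i' (by simp [hl, hu])
        have h3 : (q ++ u, i) ∉ insert (q' ++ u', i') E := by
          simp [h1.2, he]
        refine ⟨c, insert (q ++ u, i) (insert (q' ++ u', i') E), ?_, ?_, fun w => ?_⟩
        · rw [Finset.coe_insert, Set.injOn_insert (by exact_mod_cast h3), Finset.coe_insert,
            Set.injOn_insert (by simpa using h2.2)]
          refine ⟨⟨hE, h2.1⟩, ?_⟩
          rw [Set.image_insert_eq]
          rintro (h4 | h4)
          · exact he h4
          · exact h1.1 h4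
        · intro e hm
          rcases Finset.mem_insert.1 hm with rfl | hm
          · simp
          rcases Finset.mem_insert.1 hm with rfl | hm
          · simp [hl, hu]
          · have := hlen _ hm; simp; omega
        · rw [Finset.prod_insert h3, Finset.prod_insert h2.2, pairWeight, if_neg he, hp]; ring

open Classical in
/-- The contribution of the pairs of equal end vertices to the weighted sum over all pairs. -/
lemma sum_pairWeight_diag [Fintype ι] {N : ℕ} {H : ℝ≥0∞} {m : List ι → ι → ℝ≥0∞}
    {x : List ι → ℝ≥0∞} {t : ℝ≥0∞}
    (h : ∀ u, u.length < N → ∑ i, m u i * x (i :: u) = t * x u) (n : ℕ) {u u' : List ι}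
    (hu : n + u.length ≤ N) (huu : u.length = u'.length) :
    ∑ q ∈ words ι n, ∑ q' ∈ words ι n,
      (if q ++ u = q' ++ u' then pairWeight H m u u' q q' * x (q ++ u) else 0)
        = if u = u' then (H * t) ^ n * x u else 0 := by
  split_ifs with hc
  · subst hc
    calc _ = ∑ q ∈ words ι n, H ^ n * (pathWeight m q u * x (q ++ u)) := by
          refine Finset.sum_congr rfl fun q hq => ?_
          simp only [List.append_left_inj]
          rw [Finset.sum_ite_eq (words ι n) q, if_pos hq, pairWeight_self, mem_words.1 hq]
          ring
      _ = _ := by rw [← Finset.mul_sum, sum_words_pathWeight h n hu]; ring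
  · refine Finset.sum_eq_zero fun q hq => Finset.sum_eq_zero fun q' hq' => if_neg fun he => hc ?_
    exact (List.append_inj he (by simp at hq hq'; omega)).2

open Classical in
/-- The second moment recursion: if the branching factor `2 * H` is twice the bound `H` of the
weights, then the diagonal contributes only a bounded multiple of the square of the mean. -/
lemma sum_pairWeight_le [Fintype ι] {N : ℕ} {H : ℝ≥0∞} {m : List ι → ι → ℝ≥0∞}
    {x : List ι → ℝ≥0∞} {A : ℝ≥0∞} (hA : ∀ u, x u ≤ A)
    (h : ∀ u, u.length < N → ∑ i, m u i * x (i :: u) = (2 * H) * x u) (n : ℕ) {u u' : List ι}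
    (hu : n + u.length ≤ N) (huu : u.length = u'.length) :
    ∑ q ∈ words ι n, ∑ q' ∈ words ι n, pairWeight H m u u' q q' * (x (q ++ u) * x (q' ++ u'))
      ≤ ((2 * H) ^ n) ^ 2 * (x u * x u' + if u = u' then Fintype.card ι * A * x u else 0) := by
  set D : ℝ≥0∞ := if u = u' then Fintype.card ι * A * x u else 0 with hD
  suffices hs : (∑ q ∈ words ι n, ∑ q' ∈ words ι n,
      pairWeight H m u u' q q' * (x (q ++ u) * x (q' ++ u'))) + D * (H * (2 * H)) ^ n
      ≤ ((2 * H) ^ n) ^ 2 * (x u * x u' + D) from le_trans le_self_add hs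
  induction n with
  | zero => simp [words_zero, pairWeight]
  | succ n ih =>
    have ih := ih (by omega)
    have hstep : ∑ q ∈ words ι (n + 1), ∑ q' ∈ words ι (n + 1),
        pairWeight H m u u' q q' * (x (q ++ u) * x (q' ++ u'))
        ≤ (2 * H) ^ 2 * (∑ q ∈ words ι n, ∑ q' ∈ words ι n,
          pairWeight H m u u' q q' * (x (q ++ u) * x (q' ++ u')))
          + D * (H * (2 * H)) ^ (n + 1) := by
      calc _ = ∑ q ∈ words ι n, ∑ q' ∈ words ι n, ∑ i, ∑ i',
            pairWeight H m u u' (i :: q) (i' :: q') *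
              (x (i :: (q ++ u)) * x (i' :: (q' ++ u'))) := by
            simp_rw [sum_words_succ]
            refine Finset.sum_congr rfl fun q _ => ?_
            rw [Finset.sum_comm]
            simp only [List.cons_append]
        _ ≤ ∑ q ∈ words ι n, ∑ q' ∈ words ι n,
            ((2 * H) ^ 2 * (pairWeight H m u u' q q' * (x (q ++ u) * x (q' ++ u')))
            + (Fintype.card ι * A * (H * (2 * H))) *
              (if q ++ u = q' ++ u' then pairWeight H m u u' q q' * x (q ++ u) else 0)) := by
            refine Finset.sum_le_sum fun q hq => Finset.sum_le_sum fun q' hq' => ?_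
            have hq1 : (q ++ u).length < N := by simp at hq ⊢; omega
            have hq2 : (q' ++ u').length < N := by simp at hq' ⊢; omega
            by_cases he : q ++ u = q' ++ u'
            · rw [if_pos he]
              refine le_trans ?_ le_add_self
              calc _ ≤ ∑ i, ∑ _i' : ι, H * A * pairWeight H m u u' q q' *
                    (m (q ++ u) i * x (i :: (q ++ u))) := by
                    refine Finset.sum_le_sum fun i _ => Finset.sum_le_sum fun i' _ => ?_
                    rw [pairWeight, if_pos he]
                    calc _ = H * x (i' :: (q' ++ u')) * pairWeight H m u u' q q' *
                          (m (q ++ u) i * x (i :: (q ++ u))) := by ring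
                      _ ≤ _ := by gcongr; exact hA _
                _ = _ := by
                    simp_rw [Finset.sum_const, ← Finset.smul_sum, ← Finset.mul_sum]
                    rw [h _ hq1, Finset.card_univ, nsmul_eq_mul]; ring
            · rw [if_neg he, mul_zero, add_zero]
              refine le_of_eq ?_
              calc _ = ∑ i, ∑ i', pairWeight H m u u' q q' *
                    ((m (q ++ u) i * x (i :: (q ++ u))) *
                      (m (q' ++ u') i' * x (i' :: (q' ++ u')))) := by
                    refine Finset.sum_congr rfl fun i _ => Finset.sum_congr rfl fun i' _ => ?_
                    rw [pairWeight, if_neg he]; ring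
                _ = _ := by
                    simp_rw [← Finset.mul_sum, ← Finset.sum_mul]
                    rw [h _ hq1, h _ hq2]; ring
        _ = _ := by
            simp_rw [Finset.sum_add_distrib, ← Finset.mul_sum]
            rw [sum_pairWeight_diag h n (by omega) huu, hD]
            congr 1
            split_ifs
            · ring
            · simp
    calc _ ≤ (2 * H) ^ 2 * (∑ q ∈ words ι n, ∑ q' ∈ words ι n,
          pairWeight H m u u' q q' * (x (q ++ u) * x (q' ++ u')))
          + D * (H * (2 * H)) ^ (n + 1) + D * (H * (2 * H)) ^ (n + 1) := by gcongr
      _ = (2 * H) ^ 2 * ((∑ q ∈ words ι n, ∑ q' ∈ words ι n,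
          pairWeight H m u u' q q' * (x (q ++ u) * x (q' ++ u')))
          + D * (H * (2 * H)) ^ n) := by ring
      _ ≤ (2 * H) ^ 2 * (((2 * H) ^ n) ^ 2 * (x u * x u' + D)) := by gcongr
      _ = _ := by ring

end Words

/-! ### The second moment method -/


section SecondMoment

variable {Ω : Type*} [MeasurableSpace Ω]

/-- Chebyshev's inequality for the lower tail, without subtraction. -/
lemma measure_lt_half_mul_le (Q : Measure Ω) [IsProbabilityMeasure Q] {Z : Ω → ℝ≥0∞}
    (hZ : Measurable Z) {μ V : ℝ≥0∞} (hμ' : μ ≠ ∞) (h1 : ∫⁻ ω, Z ω ∂Q = μ)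
    (h2 : ∫⁻ ω, Z ω ^ 2 ∂Q ≤ μ ^ 2 + V) :
    Q {ω | Z ω < μ / 2} * μ ^ 2 ≤ 4 * V := by
  have hpt : ∀ z : ℝ≥0∞, (μ - z) ^ 2 + 2 * μ * z ≤ z ^ 2 + μ ^ 2 := by
    intro z
    rcases le_total z μ with hz | hz
    · obtain ⟨c, rfl⟩ := exists_add_of_le hz
      rw [ENNReal.add_sub_cancel_left (ne_top_of_le_ne_top hμ' hz)]
      exact le_of_eq (by ring)
    · rw [tsub_eq_zero_of_le hz]
      obtain ⟨c, rfl⟩ := exists_add_of_le hz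
      calc _ ≤ (0 : ℝ≥0∞) ^ 2 + 2 * μ * (μ + c) + c ^ 2 := le_self_add
        _ = _ := by ring
  have hd : ∫⁻ ω, (μ - Z ω) ^ 2 ∂Q ≤ V := by
    have h3 : ∫⁻ ω, ((μ - Z ω) ^ 2 + 2 * μ * Z ω) ∂Q ≤ ∫⁻ ω, (Z ω ^ 2 + μ ^ 2) ∂Q :=
      lintegral_mono fun ω => hpt (Z ω)
    rw [lintegral_add_right _ (hZ.const_mul _), lintegral_add_right _ measurable_const,
      lintegral_const_mul _ hZ, h1, lintegral_const, measure_univ, mul_one] at h3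
    have h4 : ∫⁻ ω, (μ - Z ω) ^ 2 ∂Q + 2 * μ * μ ≤ V + 2 * μ * μ :=
      h3.trans (by
        calc _ ≤ μ ^ 2 + V + μ ^ 2 := by gcongr
          _ = _ := by ring)
    exact (ENNReal.add_le_add_iff_right (by finiteness)).1 h4
  have hsub : {ω | Z ω < μ / 2} ⊆ {ω | (μ / 2) ^ 2 ≤ (μ - Z ω) ^ 2} := by
    intro ω hω
    have hω : Z ω < μ / 2 := hω
    change (μ / 2) ^ 2 ≤ (μ - Z ω) ^ 2
    refine pow_le_pow_left' ?_ 2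
    refine ENNReal.le_sub_of_add_le_left (ne_top_of_lt hω) ?_
    calc Z ω + μ / 2 ≤ μ / 2 + μ / 2 := by gcongr
      _ = μ := ENNReal.add_halves μ
  have hm := mul_meas_ge_le_lintegral (μ := Q) (f := fun ω => (μ - Z ω) ^ 2)
    ((measurable_const.sub hZ).pow_const 2) ((μ / 2) ^ 2)
  have h5 : (μ / 2) ^ 2 * 4 = μ ^ 2 := by
    calc (μ / 2) ^ 2 * 4 = (μ / 2 * 2) ^ 2 := by ring
      _ = μ ^ 2 := by rw [ENNReal.div_mul_cancel (by simp) (by simp)]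
  calc Q {ω | Z ω < μ / 2} * μ ^ 2 = 4 * ((μ / 2) ^ 2 * Q {ω | Z ω < μ / 2}) := by
        rw [← h5]; ring
    _ ≤ 4 * ((μ / 2) ^ 2 * Q {ω | (μ / 2) ^ 2 ≤ (μ - Z ω) ^ 2}) := by gcongr
    _ ≤ 4 * V := by gcongr; exact hm.trans hd

variable {ι : Type*}

/-- The mean of the product of the weights of finitely many edges with distinct upper endpoints, of
depth less than `N`, is the product of the means. -/
def HasProductMeans (Q : Measure Ω) (w : List ι → ι → Ω → ℝ≥0∞) (N : ℕ) : Prop :=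
  ∀ E : Finset (List ι × ι), Set.InjOn Prod.fst (E : Set (List ι × ι)) →
    (∀ e ∈ E, e.1.length < N) →
    ∫⁻ ω, ∏ e ∈ E, w e.1 e.2 ω ∂Q = ∏ e ∈ E, ∫⁻ ω, w e.1 e.2 ω ∂Q

lemma measurable_pathWeight {M : Type*} [MeasurableSpace M] [Mul M] [One M] [MeasurableMul₂ M]
    {w : List ι → ι → Ω → M}
    (hw : ∀ u i, Measurable (w u i)) (q u : List ι) :
    Measurable fun ω => pathWeight (fun u i => w u i ω) q u := by
  induction q with
  | nil => exact measurable_const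
  | cons i q ih => exact (hw _ _).mul ih

lemma HasProductMeans.lintegral_pathWeight {Q : Measure Ω} {w : List ι → ι → Ω → ℝ≥0∞} {N : ℕ}
    (h : HasProductMeans Q w N) {q u : List ι} (hq : q.length + u.length ≤ N) :
    ∫⁻ ω, pathWeight (fun u i => w u i ω) q u ∂Q
      = pathWeight (fun u i => ∫⁻ ω, w u i ω ∂Q) q u := by
  simp_rw [pathWeight_eq_prod]
  exact h _ (injOn_fst_edges q u) fun e he => (length_of_mem_edges he).2.trans_le hq

lemma HasProductMeans.lintegral_pairWeight {Q : Measure Ω} {w : List ι → ι → Ω → ℝ≥0∞} {N : ℕ}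
    (h : HasProductMeans Q w N) (hm : ∀ u i, Measurable (w u i)) (H : ℝ≥0∞) {q q' u u' : List ι}
    (hq : q.length + u.length ≤ N) (hqq : q.length = q'.length) (huu : u.length = u'.length) :
    ∫⁻ ω, pairWeight H (fun u i => w u i ω) u u' q q' ∂Q
      = pairWeight H (fun u i => ∫⁻ ω, w u i ω ∂Q) u u' q q' := by
  obtain ⟨c, E, hE, hlen, hp⟩ := exists_pairWeight_eq_prod H huu q q' hqq
  simp_rw [hp]
  rw [lintegral_const_mul _ (Finset.measurable_prod _ fun e _ => hm _ _),
    h E hE fun e he => (hlen e he).trans_le hq]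

/-- The second moment method, for weights which have exactly the branching factor `2 * H`. -/
lemma measure_sum_pathWeight_lt_of_eq [Fintype ι] [Nonempty ι] (Q : Measure Ω)
    [IsProbabilityMeasure Q] {w : List ι → ι → Ω → ℝ≥0∞} {N : ℕ} (h : HasProductMeans Q w N)
    (hm : ∀ u i, Measurable (w u i)) {H : ℝ≥0∞} (hH : 1 ≤ H) (hH' : H ≠ ∞)
    (hw : ∀ u i ω, w u i ω ≤ H) {x : List ι → ℝ≥0∞} {a A : ℝ≥0∞} (hA : A ≠ ∞)
    (hax : ∀ u, a ≤ x u) (hxA : ∀ u, x u ≤ A)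
    (hx : ∀ u, u.length < N → ∑ i, (∫⁻ ω, w u i ω ∂Q) * x (i :: u) = (2 * H) * x u)
    {m n : ℕ} (hN : n + m ≤ N) :
    Q {ω | A * (∑ u ∈ words ι m, ∑ q ∈ words ι n, pathWeight (fun u i => w u i ω) q u) <
        (2 * H) ^ n * a / 2} * (a ^ 2 * Fintype.card ι ^ m) ≤ 4 * (Fintype.card ι * A ^ 2) := by
  classical
  set κ : List ι → ι → ℝ≥0∞ := fun u i => ∫⁻ ω, w u i ω ∂Q with hκ
  set Z : Ω → ℝ≥0∞ := fun ω =>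
    ∑ u ∈ words ι m, ∑ q ∈ words ι n, pathWeight (fun u i => w u i ω) q u * x (q ++ u) with hZ
  set D : ℝ≥0∞ := ((Fintype.card ι : ℕ) : ℝ≥0∞) with hD
  have hD0 : D ≠ 0 := by simp [hD]
  have hDt : D ≠ ∞ := by simp [hD]
  have hcard : ((words ι m).card : ℝ≥0∞) = D ^ m := by rw [card_words]; simp [hD]
  have hZm : Measurable Z := by
    refine Finset.measurable_sum _ fun u _ => Finset.measurable_sum _ fun q _ => ?_
    exact (measurable_pathWeight hm q u).mul_const _
  set μ : ℝ≥0∞ := (2 * H) ^ n * ∑ u ∈ words ι m, x u with hμ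
  have hxs : ∑ u ∈ words ι m, x u ≠ ∞ := by
    refine ENNReal.sum_ne_top.2 fun u _ => ne_top_of_le_ne_top hA (hxA u)
  have hμt : μ ≠ ∞ := by
    rw [hμ]; finiteness
  have h1 : ∫⁻ ω, Z ω ∂Q = μ := by
    rw [hZ, lintegral_finsetSum _ fun u _ => Finset.measurable_sum _ fun q _ =>
      (measurable_pathWeight hm q u).mul_const _, hμ, Finset.mul_sum]
    refine Finset.sum_congr rfl fun u hu => ?_
    rw [lintegral_finsetSum _ fun q _ => (measurable_pathWeight hm q u).mul_const _,
      ← sum_words_pathWeight hx n (u := u) (by simp at hu; omega)]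
    refine Finset.sum_congr rfl fun q hq => ?_
    rw [lintegral_mul_const _ (measurable_pathWeight hm q u),
      h.lintegral_pathWeight (by simp at hu hq; omega)]
  have h2 : ∫⁻ ω, Z ω ^ 2 ∂Q ≤ μ ^ 2 + ((2 * H) ^ n) ^ 2 * (D ^ m * (D * A ^ 2)) := by
    have hpair : ∀ (u u' q q' : List ι), Measurable fun ω =>
        pathWeight (fun u i => w u i ω) q u * pathWeight (fun u i => w u i ω) q' u' *
          (x (q ++ u) * x (q' ++ u')) := fun u u' q q' =>
      ((measurable_pathWeight hm q u).mul (measurable_pathWeight hm q' u')).mul_const _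
    calc ∫⁻ ω, Z ω ^ 2 ∂Q
        = ∫⁻ ω, ∑ u ∈ words ι m, ∑ u' ∈ words ι m, ∑ q ∈ words ι n, ∑ q' ∈ words ι n,
          pathWeight (fun u i => w u i ω) q u * pathWeight (fun u i => w u i ω) q' u' *
          (x (q ++ u) * x (q' ++ u')) ∂Q := by
          refine lintegral_congr fun ω => ?_
          rw [sq, hZ, Finset.sum_mul_sum]
          refine Finset.sum_congr rfl fun u _ => Finset.sum_congr rfl fun u' _ => ?_
          rw [Finset.sum_mul_sum]
          refine Finset.sum_congr rfl fun q _ => Finset.sum_congr rfl fun q' _ => ?_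
          ring
      _ = ∑ u ∈ words ι m, ∑ u' ∈ words ι m, ∑ q ∈ words ι n, ∑ q' ∈ words ι n,
          (∫⁻ ω, pathWeight (fun u i => w u i ω) q u * pathWeight (fun u i => w u i ω) q' u' ∂Q) *
          (x (q ++ u) * x (q' ++ u')) := by
          rw [lintegral_finsetSum _ fun u _ => Finset.measurable_sum _ fun u' _ =>
            Finset.measurable_sum _ fun q _ => Finset.measurable_sum _ fun q' _ => hpair u u' q q']
          refine Finset.sum_congr rfl fun u _ => ?_
          rw [lintegral_finsetSum _ fun u' _ =>
            Finset.measurable_sum _ fun q _ => Finset.measurable_sum _ fun q' _ => hpair u u' q q']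
          refine Finset.sum_congr rfl fun u' _ => ?_
          rw [lintegral_finsetSum _ fun q _ => Finset.measurable_sum _ fun q' _ =>
            hpair u u' q q']
          refine Finset.sum_congr rfl fun q _ => ?_
          rw [lintegral_finsetSum _ fun q' _ => hpair u u' q q']
          refine Finset.sum_congr rfl fun q' _ => ?_
          exact lintegral_mul_const _
            ((measurable_pathWeight hm q u).mul (measurable_pathWeight hm q' u'))
      _ ≤ ∑ u ∈ words ι m, ∑ u' ∈ words ι m, ∑ q ∈ words ι n, ∑ q' ∈ words ι n,
          pairWeight H κ u u' q q' * (x (q ++ u) * x (q' ++ u')) := by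
          refine Finset.sum_le_sum fun u hu => Finset.sum_le_sum fun u' hu' =>
            Finset.sum_le_sum fun q hq => Finset.sum_le_sum fun q' hq' => mul_le_mul_left ?_ _
          rw [mem_words] at hu hu' hq hq'
          rw [← h.lintegral_pairWeight hm H (by omega) (by omega) (by omega)]
          exact lintegral_mono fun ω =>
            pathWeight_mul_le_pairWeight (fun u i => hw u i ω) u u' q q' (by omega)
      _ ≤ ∑ u ∈ words ι m, ∑ u' ∈ words ι m,
          ((2 * H) ^ n) ^ 2 * (x u * x u' + if u = u' then D * A * x u else 0) := by
          refine Finset.sum_le_sum fun u hu => Finset.sum_le_sum fun u' hu' => ?_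
          rw [mem_words] at hu hu'
          exact sum_pairWeight_le hxA hx n (by omega) (by omega)
      _ = μ ^ 2 + ((2 * H) ^ n) ^ 2 * ∑ u ∈ words ι m, D * A * x u := by
          have hsum : ∑ u ∈ words ι m, ∑ u' ∈ words ι m,
              (x u * x u' + if u = u' then D * A * x u else 0)
              = (∑ u ∈ words ι m, x u) ^ 2 + ∑ u ∈ words ι m, D * A * x u := by
            simp_rw [Finset.sum_add_distrib]
            rw [sq, Finset.sum_mul_sum]
            congr 1
            refine Finset.sum_congr rfl fun u hu => ?_
            rw [Finset.sum_ite_eq, if_pos hu]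
          generalize (2 * H) ^ n = c at hμ ⊢
          have hc : ∀ f : List ι → List ι → ℝ≥0∞, ∑ u ∈ words ι m, ∑ u' ∈ words ι m,
              c ^ 2 * f u u' = c ^ 2 * ∑ u ∈ words ι m, ∑ u' ∈ words ι m, f u u' := fun f => by
            simp_rw [Finset.mul_sum]
          rw [hc, hsum, hμ]; ring
      _ ≤ _ := by
          gcongr
          calc ∑ u ∈ words ι m, D * A * x u ≤ ∑ u ∈ words ι m, D * A * A := by
                gcongr; exact hxA _
            _ = _ := by
                rw [Finset.sum_const, nsmul_eq_mul, hcard]; ring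
  have h3 := measure_lt_half_mul_le Q hZm hμt h1 h2
  have hμa : (2 * H) ^ n * (D ^ m * a) ≤ μ := by
    rw [hμ]
    gcongr
    calc D ^ m * a = ∑ u ∈ words ι m, a := by rw [Finset.sum_const, nsmul_eq_mul, hcard]
      _ ≤ _ := Finset.sum_le_sum fun u _ => hax u
  have hD1 : 1 ≤ D := by
    rw [hD]; exact_mod_cast Fintype.card_pos
  set S := {ω | A * (∑ u ∈ words ι m, ∑ q ∈ words ι n, pathWeight (fun u i => w u i ω) q u) <
        (2 * H) ^ n * a / 2} with hS
  have hsub : S ⊆ {ω | Z ω < μ / 2} := by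
    intro ω hω
    have hω : A * (∑ u ∈ words ι m, ∑ q ∈ words ι n, pathWeight (fun u i => w u i ω) q u) <
        (2 * H) ^ n * a / 2 := hω
    refine lt_of_le_of_lt ?_ (lt_of_lt_of_le hω ?_)
    · rw [hZ, Finset.mul_sum]
      refine Finset.sum_le_sum fun u _ => ?_
      rw [Finset.mul_sum]
      refine Finset.sum_le_sum fun q _ => ?_
      rw [mul_comm A]
      exact mul_le_mul_right (hxA _) _
    · refine ENNReal.div_le_div_right (le_trans ?_ hμa) 2
      gcongr
      calc a = 1 * a := (one_mul a).symm
        _ ≤ D ^ m * a := by gcongr; exact one_le_pow₀ hD1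
  have h4 : (((2 * H) ^ n) ^ 2 * D ^ m) * (Q S * (a ^ 2 * D ^ m))
      ≤ (((2 * H) ^ n) ^ 2 * D ^ m) * (4 * (D * A ^ 2)) := by
    calc _ = Q S * ((2 * H) ^ n * (D ^ m * a)) ^ 2 := by ring
      _ ≤ Q {ω | Z ω < μ / 2} * μ ^ 2 := by gcongr
      _ ≤ _ := h3
      _ = _ := by ring
  have hH0 : H ≠ 0 := (zero_lt_one.trans_le hH).ne'
  refine (ENNReal.mul_le_mul_iff_right ?_ ?_).1 h4
  · simp [hH0, hD0]
  · finiteness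

/-- The second moment method: if the weights are bounded by `H` and have a branching factor of at
least `2 * H`, then the sum of the weights of the paths of length `n` which start at depth `m` is of
the order `(2 * H) ^ n`, with a probability which tends to one as `m → ∞`, uniformly in `n`. -/
theorem measure_sum_pathWeight_lt [Fintype ι] [Nonempty ι] (Q : Measure Ω)
    [IsProbabilityMeasure Q] {w : List ι → ι → Ω → ℝ≥0∞} {N : ℕ} (h : HasProductMeans Q w N)
    (hm : ∀ u i, Measurable (w u i)) {H : ℝ≥0∞} (hH : 1 ≤ H) (hH' : H ≠ ∞)
    (hw : ∀ u i ω, w u i ω ≤ H) {x : List ι → ℝ≥0∞} {a A : ℝ≥0∞} (ha : a ≠ 0) (hA : A ≠ ∞)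
    (hax : ∀ u, a ≤ x u) (hxA : ∀ u, x u ≤ A)
    (hx : ∀ u, u.length < N → (2 * H) * x u ≤ ∑ i, (∫⁻ ω, w u i ω ∂Q) * x (i :: u))
    {m n : ℕ} (hN : n + m ≤ N) :
    Q {ω | A * (∑ u ∈ words ι m, ∑ q ∈ words ι n, pathWeight (fun u i => w u i ω) q u) <
        (2 * H) ^ n * a / 2} * (a ^ 2 * Fintype.card ι ^ m) ≤ 4 * (Fintype.card ι * A ^ 2) := by
  -- The weights below each vertex are multiplied by a constant, so that the inequality `hx`
  -- becomes an equality.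
  set s : List ι → ℝ≥0∞ := fun u => ∑ i, (∫⁻ ω, w u i ω ∂Q) * x (i :: u) with hs
  set θ : List ι → ℝ≥0∞ := fun u => if u.length < N then (2 * H) * x u / s u else 1 with hθ
  have hθ1 : ∀ u, θ u ≤ 1 := by
    intro u
    simp only [hθ]
    split_ifs with hu
    · exact ENNReal.div_le_of_le_mul (by simpa using hx u hu)
    · exact le_rfl
  have hst : ∀ u, s u ≠ ∞ := by
    intro u
    refine ENNReal.sum_ne_top.2 fun i _ => ENNReal.mul_ne_top ?_ (ne_top_of_le_ne_top hA (hxA _))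
    refine ne_top_of_le_ne_top hH' ((lintegral_mono fun ω => hw u i ω).trans ?_)
    simp
  have hs0 : ∀ u, u.length < N → s u ≠ 0 := by
    intro u hu h0
    have h1 := hx u hu
    rw [show ∑ i, (∫⁻ ω, w u i ω ∂Q) * x (i :: u) = 0 from h0] at h1
    have h2 : (2 * H) * x u ≠ 0 := by
      simp [(zero_lt_one.trans_le hH).ne', ((pos_iff_ne_zero.2 ha).trans_le (hax u)).ne']
    exact h2 (le_antisymm h1 zero_le)
  have hle : ∀ ω, ∑ u ∈ words ι m, ∑ q ∈ words ι n, pathWeight (fun u i => θ u * w u i ω) q u ≤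
      ∑ u ∈ words ι m, ∑ q ∈ words ι n, pathWeight (fun u i => w u i ω) q u := fun ω =>
    Finset.sum_le_sum fun u _ => Finset.sum_le_sum fun q _ =>
      pathWeight_mono (fun u i => mul_le_of_le_one_left zero_le (hθ1 u)) q u
  have hint : ∀ u i, ∫⁻ ω, θ u * w u i ω ∂Q = θ u * ∫⁻ ω, w u i ω ∂Q := fun u i =>
    lintegral_const_mul _ (hm u i)
  refine le_trans (mul_le_mul_left (measure_mono fun ω hω => ?_) _)
    (measure_sum_pathWeight_lt_of_eq Q (w := fun u i ω => θ u * w u i ω) (N := N) ?_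
      (fun u i => (hm u i).const_mul _) hH hH' ?_ hA hax hxA ?_ hN)
  · exact lt_of_le_of_lt (mul_le_mul_right (hle ω) _) hω
  · intro E hE hlen
    simp_rw [hint, Finset.prod_mul_distrib]
    rw [lintegral_const_mul _ (Finset.measurable_prod _ fun e _ => hm _ _), h E hE hlen]
  · exact fun u i ω => (mul_le_of_le_one_left zero_le (hθ1 u)).trans (hw u i ω)
  · intro u hu
    simp_rw [hint, mul_assoc]
    rw [← Finset.mul_sum]
    simp only [hθ, if_pos hu]
    rw [ENNReal.div_mul_cancel (hs0 u hu) (hst u), mul_assoc]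

end SecondMoment

/-! ### Conditioning on the colours -/


section Quenched

variable {b : ℕ} {Ω₀ Ω : Type*} [MeasurableSpace Ω₀] [MeasurableSpace Ω]

/-- The law of the labels up to depth `N` when the colouring is the deterministic colouring `g`:
labels of edges with distinct upper endpoints are independent, and the label of an edge has the law
prescribed by the colours of its endpoints. -/
structure IsQuenched (P₀ : Measure Ω₀) (ξ : Fin b → Fin b → Ω₀ → ℝ) (Q : Measure Ω)
    (g : Vertex b → Fin b) (N : ℕ) (ζ : Vertex b → Fin b → Ω → ℝ) : Prop where
  indep : ∀ E : Finset (Vertex b × Fin b), Set.InjOn Prod.fst (E : Set (Vertex b × Fin b)) →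
    (∀ e ∈ E, e.1.length < N) → iIndepFun (fun (e : E) => ζ e.1.1 e.1.2) Q
  law : ∀ (u : Vertex b) (i : Fin b), u.length < N →
    Q.map (ζ u i) = P₀.map (ξ (g u) (g (i :: u)))

lemma IsQuenched.of_measure_biInter {P₀ : Measure Ω₀} {ξ : Fin b → Fin b → Ω₀ → ℝ}
    (hξ : ∀ i j, Measurable (ξ i j)) {Q : Measure Ω}
    {g : Vertex b → Fin b} {N : ℕ} {ζ : Vertex b → Fin b → Ω → ℝ} (hζ : ∀ u i, Measurable (ζ u i))
    (h : ∀ E : Finset (Vertex b × Fin b), Set.InjOn Prod.fst (E : Set (Vertex b × Fin b)) →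
      (∀ e ∈ E, e.1.length < N) → ∀ B : Vertex b × Fin b → Set ℝ, (∀ e, MeasurableSet (B e)) →
      Q (⋂ e ∈ E, ζ e.1 e.2 ⁻¹' B e) = ∏ e ∈ E, P₀ (ξ (g e.1) (g (e.2 :: e.1)) ⁻¹' B e)) :
    IsQuenched P₀ ξ Q g N ζ := by
  classical
  have hlaw : ∀ (u : Vertex b) (i : Fin b), u.length < N → ∀ B : Set ℝ, MeasurableSet B →
      Q (ζ u i ⁻¹' B) = P₀ (ξ (g u) (g (i :: u)) ⁻¹' B) := by
    intro u i hu B hB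
    simpa using h {(u, i)} (by simp) (by simpa using hu) (fun _ => B) (fun _ => hB)
  refine ⟨fun E hE hlen => ?_, fun u i hu => ?_⟩
  · rw [iIndepFun_iff_measure_inter_preimage_eq_mul]
    intro S sets hsets
    set B : Vertex b × Fin b → Set ℝ := fun e =>
      if h : ∃ h : e ∈ E, (⟨e, h⟩ : E) ∈ S then sets ⟨e, h.1⟩ else Set.univ with hB
    have hBS : ∀ e ∈ S, B e.1 = sets e := by
      intro e he
      simp only [hB]
      rw [dif_pos ⟨e.2, he⟩]
    have hBm : ∀ e, MeasurableSet (B e) := by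
      intro e
      simp only [hB]
      split_ifs with hc
      · exact hsets _ hc.2
      · exact MeasurableSet.univ
    have hsub : ∀ e ∈ S.map (Function.Embedding.subtype _), e ∈ E := by
      intro e he
      simp only [Finset.mem_map] at he
      obtain ⟨e', _, rfl⟩ := he
      exact e'.2
    have h1 := h (S.map (Function.Embedding.subtype _))
      (hE.mono fun e he => hsub e he) (fun e he => hlen e (hsub e he)) B hBm
    rw [Finset.prod_map] at h1
    have h2 : (⋂ e ∈ S, ζ e.1.1 e.1.2 ⁻¹' sets e) =
        ⋂ e ∈ S.map (Function.Embedding.subtype _), ζ e.1 e.2 ⁻¹' B e := by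
      rw [Finset.map_eq_image, Finset.set_biInter_finset_image]
      exact Set.iInter₂_congr fun e he => by simp [hBS e he]
    rw [h2, h1]
    refine Finset.prod_congr rfl fun e he => ?_
    simp only [Function.Embedding.subtype_apply]
    rw [hBS e he, hlaw _ _ (hlen _ e.2) _ (hsets e he)]
  · ext B hB
    rw [Measure.map_apply (hζ u i) hB, Measure.map_apply (hξ _ _) hB, hlaw u i hu B hB]

lemma IsQuenched.lintegral_comp {P₀ : Measure Ω₀} {ξ : Fin b → Fin b → Ω₀ → ℝ}
    (hξ : ∀ i j, Measurable (ξ i j)) {Q : Measure Ω}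
    {g : Vertex b → Fin b} {N : ℕ} {ζ : Vertex b → Fin b → Ω → ℝ} (hζ : ∀ u i, Measurable (ζ u i))
    (h : IsQuenched P₀ ξ Q g N ζ) {f : ℝ → ℝ≥0∞} (hf : Measurable f) {u : Vertex b} (i : Fin b)
    (hu : u.length < N) :
    ∫⁻ ω, f (ζ u i ω) ∂Q = ∫⁻ ω, f (ξ (g u) (g (i :: u)) ω) ∂P₀ := by
  rw [← lintegral_map hf (hζ u i), h.law u i hu, lintegral_map hf (hξ _ _)]

lemma IsQuenched.hasProductMeans {P₀ : Measure Ω₀} {ξ : Fin b → Fin b → Ω₀ → ℝ} {Q : Measure Ω}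
    {g : Vertex b → Fin b} {N : ℕ} {ζ : Vertex b → Fin b → Ω → ℝ} (hζ : ∀ u i, Measurable (ζ u i))
    (h : IsQuenched P₀ ξ Q g N ζ) {f : ℝ → ℝ≥0∞} (hf : Measurable f) :
    HasProductMeans Q (fun u i ω => f (ζ u i ω)) N := by
  intro E hE hlen
  have h1 := (h.indep E hE hlen).comp (fun _ => f) fun _ => hf
  have h2 := lintegral_prod_eq_prod_lintegral_of_indepFun Finset.univ _ h1
    fun e => hf.comp (hζ _ _)
  simp only [Function.comp_apply] at h2
  rw [Finset.prod_coe_sort E fun e => ∫⁻ ω, f (ζ e.1 e.2 ω) ∂Q] at h2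
  rw [← h2]
  refine lintegral_congr fun ω => ?_
  rw [Finset.prod_coe_sort E fun e => f (ζ e.1 e.2 ω)]

/-- Conditioning on the colours of the vertices of depth at most `N`. -/
lemma IsEnvironment.isQuenched_cond {P₀ : Measure Ω₀} [IsProbabilityMeasure P₀]
    {ξ : Fin b → Fin b → Ω₀ → ℝ} (hξ : ∀ i j, Measurable (ξ i j)) {P : Measure Ω}
    [IsProbabilityMeasure P] {c : Ω → Vertex b → Fin b} (hc : Measurable c)
    {ζ : Vertex b → Fin b → Ω → ℝ} (hζ : IsEnvironment P₀ ξ P c ζ) (g : Vertex b → Fin b) (N : ℕ)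
    {C : Set Ω} (hC : MeasurableSet[MeasurableSpace.comap c inferInstance] C)
    (hCg : ∀ ω ∈ C, ∀ v : Vertex b, v.length ≤ N → c ω v = g v) (hC0 : P C ≠ 0) :
    IsQuenched P₀ ξ P[|C] g N ζ := by
  classical
  have hm : MeasurableSpace.comap c inferInstance ≤ (inferInstance : MeasurableSpace Ω) :=
    hc.comap_le
  refine IsQuenched.of_measure_biInter hξ hζ.measurable fun E hE hlen B hB => ?_
  set S : Finset (Vertex b) := E.image Prod.fst with hS
  set e : Vertex b → Fin b := fun u => if h : ∃ i, (u, i) ∈ E then h.choose else g [] with he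
  have heE : ∀ ε ∈ E, e ε.1 = ε.2 := by
    intro ε hε
    have hex : ∃ i, (ε.1, i) ∈ E := ⟨ε.2, hε⟩
    simp only [he, dif_pos hex]
    exact congrArg Prod.snd (hE hex.choose_spec hε rfl)
  have hA : (⋂ u ∈ S, ζ u (e u) ⁻¹' B (u, e u)) = ⋂ ε ∈ E, ζ ε.1 ε.2 ⁻¹' B ε := by
    rw [hS, Finset.set_biInter_finset_image]
    exact Set.iInter₂_congr fun ε hε => by rw [heE ε hε]
  set A : Set Ω := ⋂ ε ∈ E, ζ ε.1 ε.2 ⁻¹' B ε with hAdef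
  have hAm : MeasurableSet A :=
    Finset.measurableSet_biInter _ fun ε _ => hζ.measurable _ _ (hB ε)
  have hind := hζ.cond_indep S e (fun u => B (u, e u)) fun u _ => hB _
  rw [hA] at hind
  have hlaw : ∀ᵐ ω ∂P, ∀ ε ∈ E,
      (P⟦ζ ε.1 ε.2 ⁻¹' B ε | MeasurableSpace.comap c inferInstance⟧) ω
        = P₀.real (ξ (c ω ε.1) (c ω (ε.2 :: ε.1)) ⁻¹' B ε) := by
    rw [Filter.eventually_all_finset]
    exact fun ε _ => hζ.cond_law _ _ _ (hB ε)
  have hval : ∀ᵐ ω ∂P, ω ∈ C → (P⟦A | MeasurableSpace.comap c inferInstance⟧) ω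
      = ∏ ε ∈ E, P₀.real (ξ (g ε.1) (g (ε.2 :: ε.1)) ⁻¹' B ε) := by
    filter_upwards [hind, hlaw] with ω h1 h2 hω
    rw [h1, hS, Finset.prod_image fun x hx y hy hxy => hE hx hy hxy]
    refine Finset.prod_congr rfl fun ε hε => ?_
    have h3 := hlen ε hε
    rw [heE ε hε, h2 ε hε, hCg ω hω _ h3.le, hCg ω hω _ (by simpa using h3)]
  have hint : P.real (C ∩ A) = P.real C *
      ∏ ε ∈ E, P₀.real (ξ (g ε.1) (g (ε.2 :: ε.1)) ⁻¹' B ε) := by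
    have h1 := setIntegral_condExp (μ := P) hm (f := A.indicator fun _ => (1 : ℝ))
      ((integrable_const _).indicator hAm) hC
    rw [setIntegral_congr_ae (hm _ hC) hval, setIntegral_const, setIntegral_indicator hAm,
      setIntegral_const] at h1
    simpa using h1.symm
  rw [cond_apply (hm _ hC)]
  have hprod : P (C ∩ A) = P C * ∏ ε ∈ E, P₀ (ξ (g ε.1) (g (ε.2 :: ε.1)) ⁻¹' B ε) := by
    rw [← ENNReal.toReal_eq_toReal_iff' (by finiteness) (ENNReal.mul_ne_top (by finiteness)
      (ENNReal.prod_ne_top fun _ _ => by finiteness)), ENNReal.toReal_mul, ENNReal.toReal_prod]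
    exact hint
  rw [hprod, ← mul_assoc, ENNReal.inv_mul_cancel hC0 (by finiteness), one_mul]

/-- A bound for means which holds for every deterministic proper colouring holds for the random
colouring. -/
lemma lintegral_le_of_isQuenched {P₀ : Measure Ω₀} [IsProbabilityMeasure P₀]
    {ξ : Fin b → Fin b → Ω₀ → ℝ} (hξ : ∀ i j, Measurable (ξ i j)) {P : Measure Ω}
    [IsProbabilityMeasure P] {c : Ω → Vertex b → Fin b} (hc : Measurable c)
    (hproper : ∀ᵐ ω ∂P, IsProper (c ω))
    {ζ : Vertex b → Fin b → Ω → ℝ} (hζ : IsEnvironment P₀ ξ P c ζ) (N : ℕ) {f : Ω → ℝ≥0∞}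
    {K : ℝ≥0∞}
    (h : ∀ (g : Vertex b → Fin b) (Q : Measure Ω), IsProper g → IsProbabilityMeasure Q →
      IsQuenched P₀ ξ Q g N ζ → ∫⁻ ω, f ω ∂Q ≤ K) :
    ∫⁻ ω, f ω ∂P ≤ K := by
  have hm : MeasurableSpace.comap c inferInstance ≤ (inferInstance : MeasurableSpace Ω) :=
    hc.comap_le
  let T : Set (Vertex b) := {v | v.length ≤ N}
  have hT : T.Finite := List.finite_length_le (Fin b) N
  have : Finite T := hT
  let X : Ω → (T → Fin b) := fun ω v => c ω v
  have hX : Measurable[MeasurableSpace.comap c inferInstance] X := by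
    have h1 : Measurable fun (f : Vertex b → Fin b) (v : T) => f v :=
      measurable_pi_lambda _ fun v => measurable_pi_apply _
    exact h1.comp (comap_measurable c)
  let C : (T → Fin b) → Set Ω := fun y => X ⁻¹' {y}
  have hC : ∀ y, MeasurableSet[MeasurableSpace.comap c inferInstance] (C y) :=
    fun y => hX (measurableSet_singleton y)
  have hCd : Pairwise (Function.onFun Disjoint C) := by
    intro y z hyz
    exact Disjoint.preimage X (by simpa using hyz)
  have hCu : ⋃ y, C y = Set.univ := by
    exact Set.eq_univ_of_forall fun ω => Set.mem_iUnion.2 ⟨X ω, rfl⟩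
  have hpiece : ∀ y, ∫⁻ ω in C y, f ω ∂P ≤ P (C y) * K := by
    intro y
    by_cases h0 : P (C y) = 0
    · rw [Measure.restrict_eq_zero.2 h0]; simp
    · obtain ⟨ω₁, hω₁, hp⟩ : ∃ ω₁ ∈ C y, IsProper (c ω₁) := by
        by_contra hcon
        push Not at hcon
        refine h0 (measure_mono_null (fun ω hω => ?_) hproper)
        exact hcon ω hω
      have hQ : IsProbabilityMeasure P[|C y] := cond_isProbabilityMeasure h0
      have h1 := h (c ω₁) P[|C y] hp hQ
        (hζ.isQuenched_cond hξ hc (c ω₁) N (hC y) (fun ω hω v hv => ?_) h0)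
      · rw [ProbabilityTheory.cond, lintegral_smul_measure, smul_eq_mul] at h1
        calc ∫⁻ ω in C y, f ω ∂P = P (C y) * ((P (C y))⁻¹ * ∫⁻ ω in C y, f ω ∂P) := by
              rw [← mul_assoc, ENNReal.mul_inv_cancel h0 (by finiteness), one_mul]
          _ ≤ _ := by gcongr
      · have h2 : X ω = y := hω
        have h3 : X ω₁ = y := hω₁
        exact congrFun (h2.trans h3.symm) ⟨v, hv⟩
  calc ∫⁻ ω, f ω ∂P = ∫⁻ ω in ⋃ y, C y, f ω ∂P := by rw [hCu, Measure.restrict_univ]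
    _ = ∑' y, ∫⁻ ω in C y, f ω ∂P := lintegral_iUnion (fun y => hm _ (hC y)) hCd f
    _ ≤ ∑' y, P (C y) * K := ENNReal.tsum_le_tsum hpiece
    _ = K := by
      rw [ENNReal.tsum_mul_right, ← measure_iUnion hCd fun y => hm _ (hC y), hCu, measure_univ,
        one_mul]

lemma IsEnvironment.ae_pos {P₀ : Measure Ω₀}
    {ξ : Fin b → Fin b → Ω₀ → ℝ} (hξ_pos : ∀ i j, ∀ᵐ ω ∂P₀, 0 < ξ i j ω)
    {P : Measure Ω} [IsProbabilityMeasure P] {c : Ω → Vertex b → Fin b} (hc : Measurable c)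
    {ζ : Vertex b → Fin b → Ω → ℝ} (hζ : IsEnvironment P₀ ξ P c ζ) :
    ∀ᵐ ω ∂P, ∀ u i, 0 < ζ u i ω := by
  rw [ae_all_iff]; intro u
  rw [ae_all_iff]; intro i
  have hm : MeasurableSpace.comap c inferInstance ≤ (inferInstance : MeasurableSpace Ω) :=
    hc.comap_le
  have h1 := hζ.cond_law u i (Set.Iic 0) measurableSet_Iic
  have hA : MeasurableSet (ζ u i ⁻¹' Set.Iic 0) := hζ.measurable u i measurableSet_Iic
  have h0 : ∀ k j, P₀.real (ξ k j ⁻¹' Set.Iic 0) = 0 := by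
    intro k j
    rw [measureReal_def, show P₀ (ξ k j ⁻¹' Set.Iic 0) = 0 from ?_, ENNReal.toReal_zero]
    rw [← compl_mem_ae_iff]
    filter_upwards [hξ_pos k j] with ω hω
    simpa using hω
  simp_rw [h0] at h1
  have h2 := integral_condExp (μ := P) hm (f := (ζ u i ⁻¹' Set.Iic 0).indicator fun _ => (1 : ℝ))
  rw [integral_congr_ae h1, integral_indicator hA, setIntegral_const] at h2
  have h3 : P (ζ u i ⁻¹' Set.Iic 0) = 0 := by
    simpa [measureReal_def, ENNReal.toReal_eq_zero_iff] using h2.symm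
  rw [← compl_mem_ae_iff] at h3
  filter_upwards [h3] with ω hω
  simpa using hω

/-- Below a vertex, a proper colouring uses each colour once. -/
lemma IsProper.sum_comp {g : Vertex b → Fin b} (hg : IsProper g) {M : Type*} [AddCommMonoid M]
    (u : Vertex b) (f : Fin b → M) : ∑ i, f (g (i :: u)) = ∑ j, f j :=
  (Equiv.ofBijective _ (Finite.injective_iff_bijective.1 (hg u))).sum_comp f

end Quenched

/-! ### Blocks of edges -/


section Blocks

variable {b : ℕ} {Ω₀ Ω : Type*} [MeasurableSpace Ω₀] [MeasurableSpace Ω]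

/-- Functions of disjoint groups of independent random variables are independent; in terms of
means. -/
lemma lintegral_prod_of_disjoint {κ γ : Type*} {X : κ → Ω → ℝ} {Q : Measure Ω}
    (hX : iIndepFun X Q) (hXm : ∀ i, Measurable (X i)) (T : Finset γ) (S : γ → Set κ)
    (hS : Set.PairwiseDisjoint (T : Set γ) S) (G : γ → Ω → ℝ≥0∞)
    (hG : ∀ t ∈ T, Measurable[⨆ i ∈ S t, MeasurableSpace.comap (X i) inferInstance] (G t)) :
    ∫⁻ ω, ∏ t ∈ T, G t ω ∂Q = ∏ t ∈ T, ∫⁻ ω, G t ω ∂Q := by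
  have : IsProbabilityMeasure Q := hX.isProbabilityMeasure
  have hle : ∀ i, MeasurableSpace.comap (X i) inferInstance ≤ (inferInstance : MeasurableSpace Ω) :=
    fun i => (hXm i).comap_le
  have hle' : ∀ A : Set κ, ⨆ i ∈ A, MeasurableSpace.comap (X i) inferInstance ≤
      (inferInstance : MeasurableSpace Ω) := fun A => iSup₂_le fun i _ => hle i
  induction T using Finset.cons_induction with
  | empty => simp
  | cons t T ht ih =>
    simp_rw [Finset.prod_cons]
    rw [← ih (hS.subset (by simp)) fun t' ht' => hG t' (by simp [ht'])]
    refine lintegral_mul_eq_lintegral_mul_lintegral_of_independent_measurableSpace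
      (Mf := ⨆ i ∈ S t, MeasurableSpace.comap (X i) inferInstance)
      (Mg := ⨆ i ∈ ⋃ t' ∈ T, S t', MeasurableSpace.comap (X i) inferInstance) (hle' _) (hle' _)
      (indep_iSup_of_disjoint hle hX.iIndep ?_) (hG t (by simp)) ?_
    · refine Set.disjoint_iUnion₂_right.2 fun t' ht' => hS (by simp) (by simp [ht']) ?_
      rintro rfl
      exact ht ht'
    · refine Finset.measurable_prod _ fun t' ht' => (hG t' (by simp [ht'])).mono ?_ le_rfl
      exact biSup_mono fun i hi => Set.mem_biUnion ht' hi

/-- The vertex of the `b`-ary tree which is reached by a sequence of blocks of `k` steps. -/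
def unblock {k : ℕ} : List (words (Fin b) k) → Vertex b
  | [] => []
  | p :: u => p.1 ++ unblock u

lemma length_unblock {k : ℕ} (u : List (words (Fin b) k)) :
    (unblock u).length = u.length * k := by
  induction u with
  | nil => simp [unblock]
  | cons p u ih =>
    have hp : p.1.length = k := mem_words.1 p.2
    simp [unblock, ih, hp]; ring

lemma unblock_injective {k : ℕ} (hk : 0 < k) :
    Function.Injective (unblock : List (words (Fin b) k) → Vertex b) := by
  intro u
  induction u with
  | nil =>
    intro v h
    have h1 := congrArg List.length h
    rw [length_unblock, length_unblock] at h1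
    simp only [List.length_nil, zero_mul] at h1
    rcases Nat.mul_eq_zero.1 h1.symm with h2 | h2
    · exact (List.length_eq_zero_iff.1 h2).symm
    · omega
  | cons p u ih =>
    intro v h
    cases v with
    | nil =>
      have h1 := congrArg List.length h
      rw [length_unblock, length_unblock] at h1
      simp [hk.ne'] at h1
    | cons p' v =>
      have hp : p.1.length = k := mem_words.1 p.2
      have hp' : p'.1.length = k := mem_words.1 p'.2
      obtain ⟨h1, h2⟩ := List.append_inj h (by rw [hp, hp'])
      rw [Subtype.ext h1, ih h2]

/-- Functions of the label products along blocks of `k` edges inherit the independence of the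
labels: blocks which start at distinct vertices, of depths divisible by `k`, use distinct parents. -/
lemma IsQuenched.hasProductMeans_block {P₀ : Measure Ω₀} {ξ : Fin b → Fin b → Ω₀ → ℝ}
    {Q : Measure Ω} {g : Vertex b → Fin b} {N k : ℕ} {ζ : Vertex b → Fin b → Ω → ℝ}
    (hζ : ∀ u i, Measurable (ζ u i)) (h : IsQuenched P₀ ξ Q g (N * k) ζ)
    {f : ℝ → ℝ} (hf : Measurable f) {F : ℝ → ℝ≥0∞} (hF : Measurable F) (hk : 0 < k) :
    HasProductMeans Q (fun (U : List (words (Fin b) k)) p ω =>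
      F (pathWeight (fun u i => f (ζ u i ω)) p.1 (unblock U))) N := by
  classical
  intro E hE hlen
  -- An edge determines the block to which it belongs, since depths are known modulo `k`.
  have hkey : ∀ t ∈ E, ∀ t' ∈ E, ∀ e ∈ edges t.2.1 (unblock t.1),
      ∀ e' ∈ edges t'.2.1 (unblock t'.1), e.1 = e'.1 → t = t' := by
    intro t ht t' ht' e he e' he' hee
    obtain ⟨q, hq, h1⟩ := exists_of_mem_edges he
    obtain ⟨q', hq', h2⟩ := exists_of_mem_edges he'
    rw [mem_words.1 t.2.2] at hq
    rw [mem_words.1 t'.2.2] at hq'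
    rw [h1, h2] at hee
    have hl := congrArg List.length hee
    simp only [List.length_append, length_unblock] at hl
    have hmod := congrArg (· % k) hl
    simp only [Nat.add_mul_mod_self_right, Nat.mod_eq_of_lt hq, Nat.mod_eq_of_lt hq'] at hmod
    exact hE ht ht' (unblock_injective hk (List.append_inj hee hmod).2)
  set F' : Finset (Vertex b × Fin b) := E.biUnion fun t => edges t.2.1 (unblock t.1) with hF'
  have hinj : Set.InjOn Prod.fst (F' : Set (Vertex b × Fin b)) := by
    intro e he e' he' hee
    simp only [hF', Finset.coe_biUnion, Set.mem_iUnion, Finset.mem_coe] at he he'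
    obtain ⟨t, ht, he⟩ := he
    obtain ⟨t', ht', he'⟩ := he'
    obtain rfl := hkey t ht t' ht' e he e' he' hee
    exact injOn_fst_edges _ _ he he' hee
  have hlen' : ∀ e ∈ F', e.1.length < N * k := by
    intro e he
    simp only [hF', Finset.mem_biUnion] at he
    obtain ⟨t, ht, he⟩ := he
    have h1 := (length_of_mem_edges he).2
    rw [mem_words.1 t.2.2, length_unblock] at h1
    have h2 : (t.1.length + 1) * k ≤ N * k := Nat.mul_le_mul_right k (hlen t ht)
    have h3 : (t.1.length + 1) * k = k + t.1.length * k := by ring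
    omega
  refine lintegral_prod_of_disjoint (h.indep F' hinj hlen') (fun e => hζ _ _) E
    (fun t => {e | e.1 ∈ edges t.2.1 (unblock t.1)}) ?_ _ ?_
  · intro t ht t' ht' htt
    refine Set.disjoint_left.2 fun e he he' => htt ?_
    exact hkey t ht t' ht' e.1 he e.1 he' rfl
  · intro t ht
    refine hF.comp ?_
    simp_rw [pathWeight_eq_prod]
    refine Finset.measurable_prod _ fun e he => ?_
    have heF : e ∈ F' := Finset.mem_biUnion.2 ⟨t, ht, he⟩
    exact (hf.comp (comap_measurable (ζ e.1 e.2))).mono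
      (le_iSup₂_of_le (⟨e, heF⟩ : F') he le_rfl) le_rfl

/-- A multiplicative function of the label product along a path: means of sums over all paths of
length `n`. -/
lemma IsQuenched.sum_lintegral_pathWeight_le {P₀ : Measure Ω₀} {ξ : Fin b → Fin b → Ω₀ → ℝ}
    (hξ : ∀ i j, Measurable (ξ i j)) {Q : Measure Ω} {g : Vertex b → Fin b} (hg : IsProper g)
    {N : ℕ} {ζ : Vertex b → Fin b → Ω → ℝ}
    (hζ : ∀ u i, Measurable (ζ u i)) (h : IsQuenched P₀ ξ Q g N ζ)
    {F : ℝ → ℝ≥0∞} (hF : Measurable F) {y : Fin b → ℝ≥0∞} {t : ℝ≥0∞}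
    (hy : ∀ i, ∑ j, (∫⁻ ω, F (ξ i j ω) ∂P₀) * y j ≤ t * y i) (n : ℕ) {u : Vertex b}
    (hu : n + u.length ≤ N) :
    ∑ q ∈ words (Fin b) n, (∫⁻ ω, pathWeight (fun v i => F (ζ v i ω)) q u ∂Q) * y (g (q ++ u))
      ≤ t ^ n * y (g u) := by
  have h1 := h.hasProductMeans hζ hF
  refine le_trans (le_of_eq ?_) (sum_words_pathWeight_le (N := N)
    (m := fun v i => ∫⁻ ω, F (ζ v i ω) ∂Q) (x := fun v => y (g v)) (fun v hv => ?_) n hu)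
  · refine Finset.sum_congr rfl fun q hq => ?_
    rw [h1.lintegral_pathWeight (by rw [mem_words.1 hq]; omega)]
  · refine le_trans (le_of_eq ?_) (hy (g v))
    rw [← hg.sum_comp v fun j => (∫⁻ ω, F (ξ (g v) j ω) ∂P₀) * y j]
    exact Finset.sum_congr rfl fun i _ => by rw [h.lintegral_comp hξ hζ hF i hv]

lemma IsQuenched.sum_lintegral_pathWeight {P₀ : Measure Ω₀} {ξ : Fin b → Fin b → Ω₀ → ℝ}
    (hξ : ∀ i j, Measurable (ξ i j)) {Q : Measure Ω} {g : Vertex b → Fin b} (hg : IsProper g)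
    {N : ℕ} {ζ : Vertex b → Fin b → Ω → ℝ}
    (hζ : ∀ u i, Measurable (ζ u i)) (h : IsQuenched P₀ ξ Q g N ζ)
    {F : ℝ → ℝ≥0∞} (hF : Measurable F) {y : Fin b → ℝ≥0∞} {t : ℝ≥0∞}
    (hy : ∀ i, ∑ j, (∫⁻ ω, F (ξ i j ω) ∂P₀) * y j = t * y i) (n : ℕ) {u : Vertex b}
    (hu : n + u.length ≤ N) :
    ∑ q ∈ words (Fin b) n, (∫⁻ ω, pathWeight (fun v i => F (ζ v i ω)) q u ∂Q) * y (g (q ++ u))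
      = t ^ n * y (g u) := by
  have h1 := h.hasProductMeans hζ hF
  refine Eq.trans ?_ (sum_words_pathWeight (N := N)
    (m := fun v i => ∫⁻ ω, F (ζ v i ω) ∂Q) (x := fun v => y (g v)) (fun v hv => ?_) n hu)
  · refine Finset.sum_congr rfl fun q hq => ?_
    rw [h1.lintegral_pathWeight (by rw [mem_words.1 hq]; omega)]
  · refine Eq.trans ?_ (hy (g v))
    rw [← hg.sum_comp v fun j => (∫⁻ ω, F (ξ (g v) j ω) ∂P₀) * y j]
    exact Finset.sum_congr rfl fun i _ => by rw [h.lintegral_comp hξ hζ hF i hv]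

end Blocks

/-! ### Positive matrices -/


section PerronFrobenius

open Filter Topology

variable {n : Type*} [Fintype n] [Nonempty n]

/-- Existence of a positive eigenvector of a positive matrix.  Among the vectors `u` of the simplex
and the numbers `t` with `t • u ≤ A *ᵥ u`, a pair with maximal `t` is an eigenpair: otherwise
`A *ᵥ u` would allow a larger `t`. -/
lemma exists_pos_eigenvector (A : Matrix n n ℝ) (hA : ∀ i j, 0 < A i j) :
    ∃ (r : ℝ) (x : n → ℝ), (∀ i, 0 < x i) ∧ A.mulVec x = r • x := by
  have hpos : ∀ v : n → ℝ, (∀ i, 0 ≤ v i) → v ≠ 0 → ∀ i, 0 < A.mulVec v i := by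
    intro v hv hv0 i
    obtain ⟨j, hj⟩ := Function.ne_iff.1 hv0
    refine Finset.sum_pos' (fun j _ => mul_nonneg (hA i j).le (hv j))
      ⟨j, Finset.mem_univ j, mul_pos (hA i j) (lt_of_le_of_ne (hv j) (Ne.symm hj))⟩
  set T : ℝ := ∑ i, ∑ j, A i j with hT
  have hbound : ∀ t : ℝ, ∀ u ∈ stdSimplex ℝ n, (∀ i, t * u i ≤ A.mulVec u i) → t ≤ T := by
    intro t u hu h
    calc t = ∑ i, t * u i := by rw [← Finset.mul_sum, hu.2, mul_one]
      _ ≤ ∑ i, A.mulVec u i := Finset.sum_le_sum fun i _ => h i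
      _ ≤ T := by
        refine Finset.sum_le_sum fun i _ => Finset.sum_le_sum fun j _ => ?_
        refine mul_le_of_le_one_right (hA i j).le ?_
        rw [← hu.2]
        exact Finset.single_le_sum (f := u) (fun k _ => hu.1 k) (Finset.mem_univ j)
  have hcont : ∀ i, Continuous fun u : n → ℝ => A.mulVec u i := fun i => by
    simp only [Matrix.mulVec, dotProduct]; fun_prop
  set C : Set (ℝ × (n → ℝ)) :=
    (Set.Icc 0 T ×ˢ stdSimplex ℝ n) ∩ {p | ∀ i, p.1 * p.2 i ≤ A.mulVec p.2 i} with hC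
  have hCc : IsCompact C := by
    refine (isCompact_Icc.prod (isCompact_stdSimplex ℝ n)).inter_right ?_
    rw [Set.ofPred_forall]
    refine isClosed_iInter fun i => isClosed_le (by fun_prop) ((hcont i).comp continuous_snd)
  have hmul : ∀ v : n → ℝ, (∀ i, 0 ≤ v i) → ∀ i, 0 ≤ A.mulVec v i := fun v hv i =>
    Finset.sum_nonneg fun j _ => mul_nonneg (hA i j).le (hv j)
  have hCn : C.Nonempty := by
    classical
    obtain ⟨i₀⟩ := ‹Nonempty n›
    have h0 := single_mem_stdSimplex ℝ i₀
    refine ⟨(0, Pi.single i₀ 1), ⟨⟨⟨le_rfl, ?_⟩, h0⟩, ?_⟩⟩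
    · exact Finset.sum_nonneg fun i _ => Finset.sum_nonneg fun j _ => (hA i j).le
    · intro i
      simpa using hmul _ h0.1 i
  obtain ⟨⟨t, u⟩, ⟨⟨ht, hu⟩, htu⟩, hmax⟩ := hCc.exists_isMaxOn hCn continuous_fst.continuousOn
  have hu0 : u ≠ 0 := by
    rintro rfl
    have := hu.2
    simp at this
  have hAu := hpos u hu.1 hu0
  by_cases heq : A.mulVec u = t • u
  · refine ⟨t, u, fun i => ?_, heq⟩
    have h1 := hAu i
    rw [heq] at h1
    exact pos_of_mul_pos_right (by simpa using h1) ht.1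
  · exfalso
    set d : n → ℝ := A.mulVec u - t • u with hd
    have hd' := hpos d (fun i => by simpa [hd] using htu i) (sub_ne_zero.2 heq)
    set v : n → ℝ := A.mulVec u with hv
    have hAv : ∀ i, t * v i < A.mulVec v i := by
      intro i
      have h1 := hd' i
      rw [hd, Matrix.mulVec_sub, Matrix.mulVec_smul] at h1
      simpa using h1
    obtain ⟨i₀, -, hi₀⟩ := Finset.exists_min_image Finset.univ
      (fun i => A.mulVec v i / v i) Finset.univ_nonempty
    set t' : ℝ := A.mulVec v i₀ / v i₀ with ht'
    have htt : t < t' := by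
      rw [ht', lt_div_iff₀ (hAu i₀)]; exact hAv i₀
    set σ : ℝ := ∑ i, v i with hσ
    have hσ0 : 0 < σ := Finset.sum_pos (fun i _ => hAu i) Finset.univ_nonempty
    have hmem : σ⁻¹ • v ∈ stdSimplex ℝ n := by
      refine ⟨fun i => mul_nonneg (inv_nonneg.2 hσ0.le) (hAu i).le, ?_⟩
      simp only [Pi.smul_apply, smul_eq_mul, ← Finset.mul_sum]
      exact inv_mul_cancel₀ hσ0.ne'
    have hle : ∀ i, t' * (σ⁻¹ • v) i ≤ A.mulVec (σ⁻¹ • v) i := by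
      intro i
      rw [Matrix.mulVec_smul]
      simp only [Pi.smul_apply, smul_eq_mul]
      rw [mul_left_comm]
      refine mul_le_mul_of_nonneg_left ?_ (inv_nonneg.2 hσ0.le)
      rw [← le_div_iff₀ (hAu i)]
      exact hi₀ i (Finset.mem_univ i)
    have h1 := hmax (a := (t', σ⁻¹ • v))
      ⟨⟨⟨ht.1.trans htt.le, hbound t' _ hmem hle⟩, hmem⟩, hle⟩
    exact absurd htt (not_lt.2 h1)

variable {A : Matrix n n ℝ} {r : ℝ} {x : n → ℝ}

/-- Collatz–Wielandt bound: a positive subinvariant vector bounds the Perron eigenvalue from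
above. -/
lemma eigenvalue_le_of_mulVec_le (hA : ∀ i j, 0 < A i j) (hx : ∀ i, 0 < x i)
    (hAx : A.mulVec x = r • x) {t : ℝ} {u : n → ℝ} (hu : ∀ i, 0 < u i)
    (h : ∀ i, A.mulVec u i ≤ t * u i) : r ≤ t := by
  obtain ⟨i, -, hi⟩ := Finset.exists_min_image Finset.univ (fun i => u i / x i)
    Finset.univ_nonempty
  have h1 : u i / x i * A.mulVec x i ≤ A.mulVec u i := by
    simp only [Matrix.mulVec, dotProduct, Finset.mul_sum]
    refine Finset.sum_le_sum fun j _ => ?_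
    rw [mul_left_comm]
    refine mul_le_mul_of_nonneg_left ?_ (hA i j).le
    rw [← le_div_iff₀ (hx j)]
    exact hi j (Finset.mem_univ j)
  rw [hAx, Pi.smul_apply, smul_eq_mul, mul_left_comm, div_mul_cancel₀ _ (hx i).ne'] at h1
  exact le_of_mul_le_mul_right (h1.trans (h i)) (hu i)

lemma le_eigenvalue_of_le_mulVec (hA : ∀ i j, 0 < A i j) (hx : ∀ i, 0 < x i)
    (hAx : A.mulVec x = r • x) {t : ℝ} {u : n → ℝ} (hu : ∀ i, 0 < u i)
    (h : ∀ i, t * u i ≤ A.mulVec u i) : t ≤ r := by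
  obtain ⟨i, -, hi⟩ := Finset.exists_max_image Finset.univ (fun i => u i / x i)
    Finset.univ_nonempty
  have h1 : A.mulVec u i ≤ u i / x i * A.mulVec x i := by
    simp only [Matrix.mulVec, dotProduct, Finset.mul_sum]
    refine Finset.sum_le_sum fun j _ => ?_
    rw [mul_left_comm (u i / x i)]
    refine mul_le_mul_of_nonneg_left ?_ (hA i j).le
    rw [← div_le_iff₀ (hx j)]
    exact hi j (Finset.mem_univ j)
  rw [hAx, Pi.smul_apply, smul_eq_mul, mul_left_comm, div_mul_cancel₀ _ (hx i).ne'] at h1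
  exact le_of_mul_le_mul_right ((h i).trans h1) (hu i)

/-- The eigenvalue of a positive eigenvector is the largest real eigenvalue. -/
lemma largestEigenvalue_eq {b : ℕ} [NeZero b] {A : Matrix (Fin b) (Fin b) ℝ} {r : ℝ}
    {x : Fin b → ℝ} (hA : ∀ i j, 0 < A i j) (hx : ∀ i, 0 < x i) (hAx : A.mulVec x = r • x) :
    largestEigenvalue A = r := by
  refine IsGreatest.csSup_eq ⟨?_, ?_⟩
  · refine Module.End.hasEigenvalue_of_hasEigenvector (x := x) ⟨?_, ?_⟩
    · rw [Module.End.mem_eigenspace_iff, Matrix.toLin'_apply, hAx]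
    · intro h0
      have := hx 0
      simp [h0] at this
  · intro μ hμ
    obtain ⟨v, hv⟩ := Module.End.HasEigenvalue.exists_hasEigenvector hμ
    have hv1 : A.mulVec v = μ • v := by
      have := hv.apply_eq_smul
      rwa [Matrix.toLin'_apply] at this
    obtain ⟨j₀, hj₀⟩ := Function.ne_iff.1 hv.2
    obtain ⟨i, -, hi⟩ := Finset.exists_max_image Finset.univ (fun i => |v i| / x i)
      Finset.univ_nonempty
    have hvi : 0 < |v i| := by
      have h1 : 0 < |v j₀| / x j₀ := div_pos (abs_pos.2 hj₀) (hx j₀)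
      exact (div_pos_iff_of_pos_right (hx i)).1 (h1.trans_le (hi j₀ (Finset.mem_univ _)))
    have h1 : |A.mulVec v i| ≤ |v i| / x i * A.mulVec x i := by
      simp only [Matrix.mulVec, dotProduct, Finset.mul_sum]
      refine (Finset.abs_sum_le_sum_abs _ _).trans (Finset.sum_le_sum fun j _ => ?_)
      rw [mul_left_comm (|v i| / x i), abs_mul, abs_of_pos (hA i j)]
      refine mul_le_mul_of_nonneg_left ?_ (hA i j).le
      rw [← div_le_iff₀ (hx j)]
      exact hi j (Finset.mem_univ j)
    rw [hAx, hv1, Pi.smul_apply, Pi.smul_apply, smul_eq_mul, smul_eq_mul, mul_left_comm,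
      div_mul_cancel₀ _ (hx i).ne', abs_mul] at h1
    exact (le_abs_self μ).trans (le_of_mul_le_mul_right h1 hvi)

/-- The Perron eigenvalue is algebraically simple: the range of `A - r` does not contain the
positive eigenvector `x`, hence together with `x` it spans the space. -/
lemma exists_mulVec_sub_add_smul_eq (hA : ∀ i j, 0 < A i j) (hx : ∀ i, 0 < x i)
    (hAx : A.mulVec x = r • x) (y : n → ℝ) :
    ∃ (c : ℝ) (z : n → ℝ), A.mulVec z - r • z + c • x = y := by
  obtain ⟨i₀⟩ := ‹Nonempty n›
  have : Nonempty n := ⟨i₀⟩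
  -- A vector `z` is compared with the smallest multiple of `x` which dominates it.
  have hdom : ∀ z : n → ℝ, ∃ (θ : ℝ) (i : n), (∀ j, z j ≤ θ * x j) ∧ z i = θ * x i := by
    intro z
    obtain ⟨i, -, hi⟩ := Finset.exists_max_image Finset.univ (fun i => z i / x i)
      Finset.univ_nonempty
    refine ⟨z i / x i, i, fun j => ?_, (div_mul_cancel₀ _ (hx i).ne').symm⟩
    rw [← div_le_iff₀ (hx j)]
    exact hi j (Finset.mem_univ j)
  have hnot : ∀ z : n → ℝ, A.mulVec z - r • z ≠ x := by
    intro z hz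
    obtain ⟨θ, i, hle, hi⟩ := hdom z
    have h1 : A.mulVec z i ≤ θ * A.mulVec x i := by
      simp only [Matrix.mulVec, dotProduct, Finset.mul_sum]
      refine Finset.sum_le_sum fun j _ => ?_
      rw [mul_left_comm]
      exact mul_le_mul_of_nonneg_left (hle j) (hA i j).le
    have h2 := congrFun hz i
    rw [hAx] at h1
    simp only [Pi.sub_apply, Pi.smul_apply, smul_eq_mul, hi] at h1 h2
    have h3 := hx i
    nlinarith
  have hker : ∀ z : n → ℝ, A.mulVec z = r • z → z i₀ = 0 → z = 0 := by
    intro z hz hz0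
    obtain ⟨θ, i, hle, hi⟩ := hdom z
    have h1 : ∑ j, A i j * (θ * x j - z j) = 0 := by
      have h2 := congrFun hz i
      have h3 := congrFun hAx i
      simp only [Matrix.mulVec, dotProduct, Pi.smul_apply, smul_eq_mul] at h2 h3
      calc ∑ j, A i j * (θ * x j - z j) = θ * ∑ j, A i j * x j - ∑ j, A i j * z j := by
            rw [Finset.mul_sum, ← Finset.sum_sub_distrib]
            exact Finset.sum_congr rfl fun j _ => by ring
        _ = 0 := by rw [h2, h3, hi]; ring
    rw [Finset.sum_eq_zero_iff_of_nonneg fun j _ =>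
      mul_nonneg (hA i j).le (sub_nonneg.2 (hle j))] at h1
    have h4 : ∀ j, z j = θ * x j := by
      intro j
      rcases mul_eq_zero.1 (h1 j (Finset.mem_univ j)) with h5 | h5
      · exact absurd h5 (hA i j).ne'
      · linarith
    have h6 : θ = 0 := by
      rw [h4 i₀] at hz0
      exact (mul_eq_zero.1 hz0).resolve_right (hx i₀).ne'
    ext j
    simp [h4 j, h6]
  let L : (n → ℝ) →ₗ[ℝ] (n → ℝ) :=
    A.mulVecLin - r • LinearMap.id + (LinearMap.proj i₀).smulRight x
  have hL : ∀ z, L z = A.mulVec z - r • z + z i₀ • x := fun z => by simp [L]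
  have hinj : Function.Injective L := by
    rw [injective_iff_map_eq_zero]
    intro z hz
    rw [hL] at hz
    by_cases h0 : z i₀ = 0
    · rw [h0, zero_smul, add_zero, sub_eq_zero] at hz
      exact hker z hz h0
    · refine absurd ?_ (hnot ((-(z i₀)⁻¹) • z))
      rw [Matrix.mulVec_smul, smul_comm r, ← smul_sub, eq_neg_of_add_eq_zero_left hz, smul_neg,
        neg_smul, neg_neg, smul_smul, inv_mul_cancel₀ h0, one_smul]
  obtain ⟨z, hz⟩ := LinearMap.injective_iff_surjective.1 hinj y
  exact ⟨z i₀, z, by rw [← hL, hz]⟩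

/-- First order perturbation of the Perron eigenvalue: there is a number `r'` (its derivative) such
that `A (s + δ)` has positive subinvariant vectors with factors `r + δ r' + o(δ)`. -/
lemma exists_perturbed_subinvariant {A : ℝ → Matrix n n ℝ} {A' : Matrix n n ℝ} {s : ℝ}
    (hd : ∀ i j, HasDerivAt (fun t => A t i j) (A' i j) s) (hA : ∀ i j, 0 < A s i j)
    (hx : ∀ i, 0 < x i) (hAx : (A s).mulVec x = r • x) :
    ∃ r' : ℝ, ∀ ε > 0, ∀ᶠ δ in 𝓝 (0 : ℝ), ∃ u : n → ℝ, (∀ i, 0 < u i) ∧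
      ∀ i, (A (s + δ)).mulVec u i ≤ (r + δ * r' + ε * |δ|) * u i := by
  obtain ⟨r', z, hz⟩ := exists_mulVec_sub_add_smul_eq hA hx hAx (A'.mulVec x)
  refine ⟨r', fun ε hε => ?_⟩
  let h : n → ℝ → ℝ := fun i δ =>
    (∑ j, A (s + δ) i j * (x j - δ * z j)) - (r + δ * r') * (x i - δ * z i)
  have hh0 : ∀ i, h i 0 = 0 := by
    intro i
    have h1 := congrFun hAx i
    simp only [Matrix.mulVec, dotProduct, Pi.smul_apply, smul_eq_mul] at h1
    simp [h, h1]
  have hh : ∀ i, HasDerivAt (h i) 0 0 := by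
    intro i
    have hAd : ∀ j, HasDerivAt (fun δ => A (s + δ) i j) (A' i j) 0 := by
      intro j
      have h1 : HasDerivAt (fun t => A t i j) (A' i j) (s + 0) := by simpa using hd i j
      simpa using h1.comp_const_add s 0
    have hl : ∀ j, HasDerivAt (fun δ : ℝ => x j - δ * z j) (-z j) 0 := by
      intro j
      simpa using ((hasDerivAt_id (0 : ℝ)).mul_const (z j)).const_sub (x j)
    have hr : HasDerivAt (fun δ : ℝ => r + δ * r') r' 0 := by
      simpa using ((hasDerivAt_id (0 : ℝ)).mul_const r').const_add r
    have h1 := (HasDerivAt.fun_sum (u := Finset.univ) fun j _ => (hAd j).mul (hl j)).sub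
      (hr.mul (hl i))
    refine h1.congr_deriv ?_
    have h2 := congrFun hz i
    simp only [Matrix.mulVec, dotProduct, Pi.smul_apply, smul_eq_mul, Pi.add_apply,
      Pi.sub_apply] at h2
    simp only [add_zero, zero_mul, sub_zero, mul_neg, Finset.sum_add_distrib,
      Finset.sum_neg_distrib]
    linarith
  have hsmall : ∀ᶠ δ in 𝓝 (0 : ℝ), ∀ i, |h i δ| ≤ ε * (x i / 2) * |δ| := by
    rw [eventually_all]
    intro i
    have h1 := (hasDerivAt_iff_isLittleO.1 (hh i)).def
      (show 0 < ε * (x i / 2) from mul_pos hε (half_pos (hx i)))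
    filter_upwards [h1] with δ hδ
    simpa [hh0 i] using hδ
  have hhalf : ∀ᶠ δ in 𝓝 (0 : ℝ), ∀ i, x i / 2 < x i - δ * z i := by
    rw [eventually_all]
    intro i
    have hc : ContinuousAt (fun δ : ℝ => x i - δ * z i) 0 := by fun_prop
    refine hc.eventually (lt_mem_nhds ?_)
    have := hx i
    simp; linarith
  filter_upwards [hsmall, hhalf] with δ h1 h2
  refine ⟨fun i => x i - δ * z i, fun i => (half_pos (hx i)).trans (h2 i), fun i => ?_⟩
  have h3 := (le_abs_self _).trans (h1 i)
  have h4 : ε * (x i / 2) * |δ| ≤ ε * |δ| * (x i - δ * z i) := by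
    have := mul_le_mul_of_nonneg_left (h2 i).le (mul_nonneg hε.le (abs_nonneg δ))
    linarith
  simp only [Matrix.mulVec, dotProduct]
  simp only [h] at h3
  linarith

/-- At a minimiser `s` of the Perron eigenvalue `r` over `[0, 1]` the derivative is nonpositive if
`0 < s` and nonnegative if `s < 1`.  This is expressed by subinvariant vectors. -/
lemma exists_minimiser {A A' : ℝ → Matrix n n ℝ}
    (hd : ∀ s i j, HasDerivAt (fun t => A t i j) (A' s i j) s) (hA : ∀ s i j, 0 < A s i j)
    (h1 : ∀ s ∈ Set.Icc (0 : ℝ) 1, ∃ u : n → ℝ, (∀ i, 0 < u i) ∧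
      ∀ i, u i < (A s).mulVec u i) :
    ∃ s ∈ Set.Icc (0 : ℝ) 1, ∃ r > 1, ∃ x : n → ℝ, (∀ i, 0 < x i) ∧ (A s).mulVec x = r • x ∧
      (0 < s → ∀ ε > 0, ∃ δ > 0, ∃ u : n → ℝ, (∀ i, 0 < u i) ∧
        ∀ i, (A (s + δ)).mulVec u i ≤ (r + ε * δ) * u i) ∧
      (s < 1 → ∀ ε > 0, ∃ δ > 0, ∃ u : n → ℝ, (∀ i, 0 < u i) ∧
        ∀ i, (A (s - δ)).mulVec u i ≤ (r + ε * δ) * u i) := by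
  choose ρ y hy hρ using fun s => exists_pos_eigenvector (A s) (hA s)
  have hlsc : LowerSemicontinuous ρ := by
    intro s t ht
    obtain ⟨t', htt', ht'⟩ := exists_between ht
    have hev : ∀ᶠ s' in 𝓝 s, ∀ i, t' * y s i < (A s').mulVec (y s) i := by
      rw [eventually_all]
      intro i
      have hc : ContinuousAt (fun s' => (A s').mulVec (y s) i) s := by
        simp only [Matrix.mulVec, dotProduct]
        exact tendsto_finsetSum _ fun j _ => (hd s i j).continuousAt.mul continuousAt_const
      refine hc.eventually (lt_mem_nhds ?_)
      beta_reduce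
      rw [hρ s]
      exact mul_lt_mul_of_pos_right ht' (hy s i)
    filter_upwards [hev] with s' hs'
    exact htt'.trans_le (le_eigenvalue_of_le_mulVec (hA s') (hy s') (hρ s') (hy s)
      fun i => (hs' i).le)
  obtain ⟨s, hs, hmin⟩ := (hlsc.lowerSemicontinuousOn (Set.Icc (0 : ℝ) 1)).exists_isMinOn
    (Set.nonempty_Icc.2 zero_le_one) isCompact_Icc
  obtain ⟨r', hr'⟩ := exists_perturbed_subinvariant (hd s) (hA s) (hy s) (hρ s)
  have hle : ∀ δ ε : ℝ, s + δ ∈ Set.Icc (0 : ℝ) 1 → (∃ u : n → ℝ, (∀ i, 0 < u i) ∧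
      ∀ i, (A (s + δ)).mulVec u i ≤ (ρ s + δ * r' + ε * |δ|) * u i) → 0 ≤ δ * r' + ε * |δ| := by
    rintro δ ε hδ ⟨u, hu, hAu⟩
    have h2 := eigenvalue_le_of_mulVec_le (hA _) (hy _) (hρ (s + δ)) hu hAu
    have h3 : ρ s ≤ ρ (s + δ) := hmin hδ
    linarith
  have hneg : 0 < s → r' ≤ 0 := by
    intro hs0
    refine le_of_forall_pos_le_add fun ε hε => ?_
    have hmem : ∀ᶠ δ in 𝓝[<] (0 : ℝ), δ < 0 := self_mem_nhdsWithin
    have hev : ∀ᶠ δ in 𝓝[<] (0 : ℝ), -s < δ :=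
      eventually_nhdsWithin_of_eventually_nhds (lt_mem_nhds (by linarith))
    obtain ⟨δ, hδ, hδ0, hδs⟩ := ((eventually_nhdsWithin_of_eventually_nhds (hr' ε hε)).and
      (hmem.and hev)).exists
    have hδ0 : δ < 0 := hδ0
    have h2 := hle δ ε ⟨by linarith, by linarith [hs.2]⟩ hδ
    rw [abs_of_neg hδ0] at h2
    nlinarith
  have hpos : s < 1 → 0 ≤ r' := by
    intro hs1
    refine le_of_forall_pos_le_add fun ε hε => ?_
    have hmem : ∀ᶠ δ in 𝓝[>] (0 : ℝ), δ > 0 := self_mem_nhdsWithin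
    have hev : ∀ᶠ δ in 𝓝[>] (0 : ℝ), δ < 1 - s :=
      eventually_nhdsWithin_of_eventually_nhds (gt_mem_nhds (by linarith))
    obtain ⟨δ, hδ, hδ0, hδs⟩ := ((eventually_nhdsWithin_of_eventually_nhds (hr' ε hε)).and
      (hmem.and hev)).exists
    have hδ0 : 0 < δ := hδ0
    have h2 := hle δ ε ⟨by linarith [hs.1], by linarith⟩ hδ
    rw [abs_of_pos hδ0] at h2
    nlinarith
  refine ⟨s, hs, ρ s, ?_, y s, hy s, hρ s, fun hs0 ε hε => ?_, fun hs1 ε hε => ?_⟩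
  · obtain ⟨u, hu, hAu⟩ := h1 s hs
    -- A strict inequality persists for a factor slightly larger than one.
    obtain ⟨i₀, -, hi₀⟩ := Finset.exists_min_image Finset.univ
      (fun i => (A s).mulVec u i / u i) Finset.univ_nonempty
    refine lt_of_lt_of_le ((one_lt_div (hu i₀)).2 (hAu i₀))
      (le_eigenvalue_of_le_mulVec (hA s) (hy s) (hρ s) hu fun i => ?_)
    rw [← le_div_iff₀ (hu i)]
    exact hi₀ i (Finset.mem_univ i)
  · obtain ⟨δ, ⟨u, hu, hAu⟩, hδ0⟩ := ((eventually_nhdsWithin_of_eventually_nhds (hr' ε hε)).and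
      (self_mem_nhdsWithin : Set.Ioi (0 : ℝ) ∈ 𝓝[>] 0)).exists
    have hδ0 : 0 < δ := hδ0
    refine ⟨δ, hδ0, u, hu, fun i => (hAu i).trans (mul_le_mul_of_nonneg_right ?_ (hu i).le)⟩
    rw [abs_of_pos hδ0]
    nlinarith [hneg hs0]
  · obtain ⟨δ, ⟨u, hu, hAu⟩, hδ0⟩ := ((eventually_nhdsWithin_of_eventually_nhds (hr' ε hε)).and
      (self_mem_nhdsWithin : Set.Iio (0 : ℝ) ∈ 𝓝[<] 0)).exists
    have hδ0 : δ < 0 := hδ0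
    refine ⟨-δ, by linarith, u, hu, fun i => ?_⟩
    rw [sub_neg_eq_add]
    refine (hAu i).trans (mul_le_mul_of_nonneg_right ?_ (hu i).le)
    rw [abs_of_neg hδ0]
    nlinarith [hpos hs1]

end PerronFrobenius

/-! ### Finiteness of the sum -/


section Finite

variable {b : ℕ} {Ω₀ Ω : Type*} [MeasurableSpace Ω₀] [MeasurableSpace Ω]

lemma tsum_eq_tsum_sum_words {ι : Type*} [Finite ι] (f : List ι → ℝ≥0∞) :
    ∑' v, f v = ∑' n, ∑ v ∈ words ι n, f v := by
  rw [← (Equiv.sigmaFiberEquiv (List.length : List ι → ℕ)).tsum_eq, ENNReal.tsum_sigma']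
  refine tsum_congr fun n => ?_
  rw [← Finset.tsum_subtype]
  refine (Equiv.subtypeEquivRight fun v => ?_).tsum_eq fun v : words ι n => f v
  simp

lemma pathWeight_pos {ι : Type*} {w : List ι → ι → ℝ} (h : ∀ u i, 0 < w u i) (q u : List ι) :
    0 < pathWeight w q u := by
  induction q with
  | nil => exact one_pos
  | cons i q ih => exact mul_pos (h _ _) ih

lemma pathWeight_ofReal_rpow {ι : Type*} {w : List ι → ι → ℝ} (h : ∀ u i, 0 < w u i) (s : ℝ)
    (q u : List ι) :
    pathWeight (fun u i => ENNReal.ofReal (w u i ^ s)) q u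
      = ENNReal.ofReal (pathWeight w q u ^ s) := by
  induction q with
  | nil => simp
  | cons i q ih =>
    rw [pathWeight_cons, pathWeight_cons, ih, Real.mul_rpow (h _ _).le (pathWeight_pos h q u).le,
      ENNReal.ofReal_mul (Real.rpow_nonneg (h _ _).le s)]

/-- If positive numbers have a finite sum of powers of order `s ≤ 1`, then all but finitely many of
them are below one, and the numbers are summable as well. -/
lemma tsum_ofReal_lt_top_of_rpow {α : Type*} {p : α → ℝ} (hp : ∀ v, 0 < p v) {s : ℝ} (hs0 : 0 ≤ s)
    (hs1 : s ≤ 1) (h : ∑' v, ENNReal.ofReal (p v ^ s) < ∞) :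
    ∑' v, ENNReal.ofReal (p v) < ∞ := by
  have h1 : Summable fun v => p v ^ s := by
    have h2 := ENNReal.summable_toReal h.ne
    simpa [ENNReal.toReal_ofReal, Real.rpow_nonneg (hp _).le] using h2
  have h3 : Summable p := by
    refine Summable.of_norm_bounded_eventually h1 ?_
    filter_upwards [h1.tendsto_cofinite_zero.eventually (gt_mem_nhds one_pos)] with v hv
    have hv1 : p v ≤ 1 := by
      by_contra hcon
      exact absurd hv (not_lt.2 (Real.one_le_rpow (not_le.1 hcon).le hs0))
    rw [Real.norm_of_nonneg (hp v).le]
    simpa using Real.rpow_le_rpow_of_exponent_ge (hp v) hv1 hs1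
  exact lt_top_iff_ne_top.2 h3.tsum_ofReal_ne_top

lemma moment_pos {P₀ : Measure Ω₀} [IsProbabilityMeasure P₀] {ξ : Fin b → Fin b → Ω₀ → ℝ}
    (hξ_meas : ∀ i j, Measurable (ξ i j)) (hξ_pos : ∀ i j, ∀ᵐ ω ∂P₀, 0 < ξ i j ω) (s : ℝ)
    (i j : Fin b) : 0 < moment P₀ ξ s i j := by
  rw [moment, pos_iff_ne_zero, Ne,
    lintegral_eq_zero_iff (((hξ_meas i j).pow_const s).ennreal_ofReal)]
  intro h0
  obtain ⟨ω, h1, h2⟩ := (h0.and (hξ_pos i j)).exists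
  simp only [Pi.zero_apply, ENNReal.ofReal_eq_zero] at h1
  exact absurd (Real.rpow_pos_of_pos h2 s) (not_lt.2 h1)

/-- A positive eigenvector of the matrix of moments, in terms of the largest eigenvalue. -/
lemma exists_eigenvector_moment [NeZero b] {P₀ : Measure Ω₀} [IsProbabilityMeasure P₀]
    {ξ : Fin b → Fin b → Ω₀ → ℝ} (hξ_meas : ∀ i j, Measurable (ξ i j))
    (hξ_pos : ∀ i j, ∀ᵐ ω ∂P₀, 0 < ξ i j ω) {s : ℝ} (hs : s ∈ finiteMoments P₀ ξ) :
    ∃ (r : ℝ) (x : Fin b → ℝ), (∀ i, 0 < x i) ∧ rho P₀ ξ s = ENNReal.ofReal r ∧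
      ∀ i, ∑ j, (moment P₀ ξ s i j).toReal * x j = r * x i := by
  have hA : ∀ i j, 0 < (Matrix.of fun i j => (moment P₀ ξ s i j).toReal : Matrix _ _ ℝ) i j :=
    fun i j => ENNReal.toReal_pos (moment_pos hξ_meas hξ_pos s i j).ne' (hs i j).ne
  obtain ⟨r, x, hx, hAx⟩ := exists_pos_eigenvector _ hA
  refine ⟨r, x, hx, ?_, fun i => congrFun hAx i⟩
  rw [rho, if_pos hs, largestEigenvalue_eq hA hx hAx]

/-- If the largest eigenvalue of the matrix of moments of some order `s ∈ [0, 1]` is less than one,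
then the sum of the powers of order `s` has a finite mean. -/
theorem ae_totalSum_lt_top [NeZero b] {P₀ : Measure Ω₀} [IsProbabilityMeasure P₀]
    {ξ : Fin b → Fin b → Ω₀ → ℝ} (hξ_meas : ∀ i j, Measurable (ξ i j))
    (hξ_pos : ∀ i j, ∀ᵐ ω ∂P₀, 0 < ξ i j ω) {P : Measure Ω} [IsProbabilityMeasure P]
    {c : Ω → Vertex b → Fin b} (hc : Measurable c) (hproper : ∀ᵐ ω ∂P, IsProper (c ω))
    {ζ : Vertex b → Fin b → Ω → ℝ} (hζ : IsEnvironment P₀ ξ P c ζ) (h : lambdaOne P₀ ξ < 1) :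
    ∀ᵐ ω ∂P, totalSum ζ ω < ∞ := by
  obtain ⟨s, hs, hr1⟩ : ∃ s ∈ Set.Icc (0 : ℝ) 1, rho P₀ ξ s < 1 := by
    rw [lambdaOne] at h
    simpa only [iInf_lt_iff, exists_prop] using h
  have hsD : s ∈ finiteMoments P₀ ξ := by
    by_contra hcon
    rw [rho, if_neg hcon] at hr1
    exact absurd hr1 (by simp)
  obtain ⟨r, x, hx, hrho, hAx⟩ := exists_eigenvector_moment hξ_meas hξ_pos hsD
  rw [hrho] at hr1
  set t : ℝ≥0∞ := ENNReal.ofReal r with ht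
  set F : ℝ → ℝ≥0∞ := fun z => ENNReal.ofReal (z ^ s) with hF
  have hFm : Measurable F := (measurable_id.pow_const s).ennreal_ofReal
  set y : Fin b → ℝ≥0∞ := fun i => ENNReal.ofReal (x i) with hy
  have hyt : ∀ i, ∑ j, (∫⁻ ω, F (ξ i j ω) ∂P₀) * y j ≤ t * y i := by
    intro i
    rw [ht, hy, ← ENNReal.ofReal_mul' (hx i).le, ← hAx i, ENNReal.ofReal_sum_of_nonneg
      fun j _ => mul_nonneg ENNReal.toReal_nonneg (hx j).le]
    refine Finset.sum_le_sum fun j _ => le_of_eq ?_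
    rw [ENNReal.ofReal_mul ENNReal.toReal_nonneg, ENNReal.ofReal_toReal (hsD i j).ne]
    rfl
  obtain ⟨i₀, -, hi₀⟩ := Finset.exists_min_image Finset.univ y Finset.univ_nonempty
  obtain ⟨i₁, -, hi₁⟩ := Finset.exists_max_image Finset.univ y Finset.univ_nonempty
  have hy0 : y i₀ ≠ 0 := by simpa [hy] using hx i₀
  have hyt' : ∀ i, y i ≠ ∞ := fun i => ENNReal.ofReal_ne_top
  set S : ℕ → Ω → ℝ≥0∞ := fun n ω =>
    ∑ q ∈ words (Fin b) n, pathWeight (fun u i => F (ζ u i ω)) q [] with hS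
  have hFζ : ∀ u i, Measurable fun ω => F (ζ u i ω) := fun u i => hFm.comp (hζ.measurable u i)
  have hSm : ∀ n, Measurable (S n) := fun n =>
    Finset.measurable_sum _ fun q _ => measurable_pathWeight hFζ q []
  have hSint : ∀ n, ∫⁻ ω, S n ω ∂P ≤ t ^ n * (y i₁ / y i₀) := by
    intro n
    refine lintegral_le_of_isQuenched hξ_meas hc hproper hζ n fun g Q hg hQ hq => ?_
    have h1 := hq.sum_lintegral_pathWeight_le hξ_meas hg hζ.measurable hFm hyt n (u := [])
      (by simp)
    rw [← mul_div_assoc, ENNReal.le_div_iff_mul_le (Or.inl hy0) (Or.inl (hyt' _)), hS,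
      lintegral_finsetSum _ fun q _ => measurable_pathWeight hFζ q [], Finset.sum_mul]
    refine (Finset.sum_le_sum fun q _ => ?_).trans (h1.trans ?_)
    · exact mul_le_mul_right (hi₀ _ (Finset.mem_univ _)) _
    · exact mul_le_mul_right (hi₁ _ (Finset.mem_univ _)) _
  have hsum : ∫⁻ ω, ∑' n, S n ω ∂P ≠ ∞ := by
    rw [lintegral_tsum fun n => (hSm n).aemeasurable]
    refine ne_top_of_le_ne_top ?_ (ENNReal.tsum_le_tsum hSint)
    rw [ENNReal.tsum_mul_right, ENNReal.tsum_geometric]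
    refine ENNReal.mul_ne_top ?_ (ENNReal.div_ne_top (hyt' _) hy0)
    exact ENNReal.inv_ne_top.2 (tsub_pos_of_lt hr1).ne'
  filter_upwards [ae_lt_top (Measurable.tsum hSm) hsum, hζ.ae_pos hξ_pos hc]
    with ω h1 h2
  have h3 : ∀ v, 0 < pathProd ζ ω v := fun v => by
    rw [pathProd_eq_pathWeight]; exact pathWeight_pos h2 v []
  refine tsum_ofReal_lt_top_of_rpow h3 hs.1 hs.2 ?_
  rw [tsum_eq_tsum_sum_words]
  refine lt_of_le_of_lt (le_of_eq ?_) h1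
  refine tsum_congr fun n => Finset.sum_congr rfl fun v _ => ?_
  rw [pathProd_eq_pathWeight, ← pathWeight_ofReal_rpow h2]

end Finite

/-! ### Truncated labels -/


section Truncation

open Filter Topology

variable {b : ℕ} {Ω₀ Ω : Type*} [MeasurableSpace Ω₀] [MeasurableSpace Ω]

/-- A label which is replaced by zero unless it belongs to `[M⁻¹, M]`. -/
noncomputable def truncLabel (M z : ℝ) : ℝ := (Set.Icc M⁻¹ M).indicator id z

lemma measurable_truncLabel (M : ℝ) : Measurable (truncLabel M) :=
  measurable_id.indicator measurableSet_Icc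

lemma truncLabel_nonneg {M : ℝ} (hM : 1 ≤ M) (z : ℝ) : 0 ≤ truncLabel M z := by
  refine Set.indicator_nonneg (fun z hz => ?_) z
  exact (inv_nonneg.2 (zero_le_one.trans hM)).trans hz.1

lemma truncLabel_le {z : ℝ} (M : ℝ) (hz : 0 ≤ z) : truncLabel M z ≤ z :=
  Set.indicator_le_self' (fun _ _ => hz) z

/-- The power `z ^ t` of a positive number, extended by zero to all real numbers (whatever the sign
of `t`). -/
noncomputable def posPow (t z : ℝ) : ℝ≥0∞ := if 0 < z then ENNReal.ofReal (z ^ t) else 0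

lemma measurable_posPow (t : ℝ) : Measurable (posPow t) :=
  Measurable.ite measurableSet_Ioi (measurable_id.pow_const t).ennreal_ofReal measurable_const

lemma posPow_mul (t : ℝ) {y z : ℝ} (hy : 0 ≤ y) (hz : 0 ≤ z) :
    posPow t (y * z) = posPow t y * posPow t z := by
  rcases hy.eq_or_lt with rfl | hy
  · simp [posPow]
  rcases hz.eq_or_lt with rfl | hz
  · simp [posPow]
  rw [posPow, posPow, posPow, if_pos hy, if_pos hz, if_pos (mul_pos hy hz),
    Real.mul_rpow hy.le hz.le, ENNReal.ofReal_mul (Real.rpow_nonneg hy.le t)]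

lemma pathWeight_nonneg {ι : Type*} {w : List ι → ι → ℝ} (h : ∀ u i, 0 ≤ w u i) (q u : List ι) :
    0 ≤ pathWeight w q u := by
  induction q with
  | nil => exact zero_le_one
  | cons i q ih => exact mul_nonneg (h _ _) ih

lemma posPow_pathWeight {ι : Type*} {w : List ι → ι → ℝ} (h : ∀ u i, 0 ≤ w u i) (t : ℝ)
    (q u : List ι) :
    posPow t (pathWeight w q u) = pathWeight (fun u i => posPow t (w u i)) q u := by
  induction q with
  | nil => simp [posPow]
  | cons i q ih =>
    rw [pathWeight_cons, pathWeight_cons, ← ih, posPow_mul t (h _ _) (pathWeight_nonneg h q u)]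

/-- The matrix of the moments of order `t` of the truncated labels. -/
noncomputable def truncMoment (P₀ : Measure Ω₀) (ξ : Fin b → Fin b → Ω₀ → ℝ) (M t : ℝ) :
    Matrix (Fin b) (Fin b) ℝ :=
  Matrix.of fun i j =>
    mgf (fun ω => Real.log (ξ i j ω)) (P₀.restrict (ξ i j ⁻¹' Set.Icc M⁻¹ M)) t

variable {P₀ : Measure Ω₀} {ξ : Fin b → Fin b → Ω₀ → ℝ}

lemma integrable_exp_mul_log_truncated [IsProbabilityMeasure P₀]
    (hξ_meas : ∀ i j, Measurable (ξ i j)) {M : ℝ} (hM : 1 ≤ M)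
    (t : ℝ) (i j : Fin b) :
    Integrable (fun ω => Real.exp (t * Real.log (ξ i j ω)))
      (P₀.restrict (ξ i j ⁻¹' Set.Icc M⁻¹ M)) := by
  have hM0 : 0 < M := zero_lt_one.trans_le hM
  refine integrable_exp_mul_of_mem_Icc (a := Real.log M⁻¹) (b := Real.log M)
    (Real.measurable_log.comp (hξ_meas i j)).aemeasurable ?_
  refine (ae_restrict_iff' (hξ_meas i j measurableSet_Icc)).2 (ae_of_all _ fun ω hω => ?_)
  have h1 : M⁻¹ ≤ ξ i j ω := hω.1
  have h2 : ξ i j ω ≤ M := hω.2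
  exact ⟨Real.log_le_log (inv_pos.2 hM0) h1, Real.log_le_log ((inv_pos.2 hM0).trans_le h1) h2⟩

lemma hasDerivAt_truncMoment [IsProbabilityMeasure P₀]
    (hξ_meas : ∀ i j, Measurable (ξ i j)) {M : ℝ} (hM : 1 ≤ M)
    (t : ℝ) (i j : Fin b) :
    HasDerivAt (fun s => truncMoment P₀ ξ M s i j)
      (∫ ω in ξ i j ⁻¹' Set.Icc M⁻¹ M,
        Real.log (ξ i j ω) * Real.exp (t * Real.log (ξ i j ω)) ∂P₀) t := by
  refine hasDerivAt_mgf ?_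
  have : integrableExpSet (fun ω => Real.log (ξ i j ω))
      (P₀.restrict (ξ i j ⁻¹' Set.Icc M⁻¹ M)) = Set.univ :=
    Set.eq_univ_of_forall fun s => integrable_exp_mul_log_truncated hξ_meas hM s i j
  simp [this]

lemma lintegral_posPow_truncLabel [IsProbabilityMeasure P₀]
    (hξ_meas : ∀ i j, Measurable (ξ i j)) {M : ℝ} (hM : 1 ≤ M)
    (t : ℝ) (i j : Fin b) :
    ∫⁻ ω, posPow t (truncLabel M (ξ i j ω)) ∂P₀ = ENNReal.ofReal (truncMoment P₀ ξ M t i j) := by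
  have hM0 : 0 < M := zero_lt_one.trans_le hM
  have hS : MeasurableSet (ξ i j ⁻¹' Set.Icc M⁻¹ M) := hξ_meas i j measurableSet_Icc
  rw [truncMoment, Matrix.of_apply, mgf, ofReal_integral_eq_lintegral_ofReal
    (integrable_exp_mul_log_truncated hξ_meas hM t i j)
    (ae_of_all _ fun ω => (Real.exp_pos _).le), ← lintegral_indicator hS]
  refine lintegral_congr fun ω => ?_
  by_cases hω : ω ∈ ξ i j ⁻¹' Set.Icc M⁻¹ M
  · have h0 : 0 < ξ i j ω := (inv_pos.2 hM0).trans_le hω.1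
    have h1 : truncLabel M (ξ i j ω) = ξ i j ω :=
      Set.indicator_of_mem (s := Set.Icc M⁻¹ M) hω id
    rw [Set.indicator_of_mem hω, h1, posPow, if_pos h0, Real.rpow_def_of_pos h0, mul_comm]
  · have h1 : truncLabel M (ξ i j ω) = 0 :=
      Set.indicator_of_notMem (s := Set.Icc M⁻¹ M) hω id
    rw [Set.indicator_of_notMem hω, h1, posPow, if_neg (lt_irrefl 0)]

lemma truncMoment_mono [IsProbabilityMeasure P₀]
    (hξ_meas : ∀ i j, Measurable (ξ i j)) {M M' : ℝ} (hM : 1 ≤ M)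
    (hMM : M ≤ M') (t : ℝ) (i j : Fin b) :
    truncMoment P₀ ξ M t i j ≤ truncMoment P₀ ξ M' t i j := by
  refine setIntegral_mono_set (integrable_exp_mul_log_truncated hξ_meas (hM.trans hMM) t i j)
    (ae_of_all _ fun ω => (Real.exp_pos _).le) (Filter.Eventually.of_forall ?_)
  exact Set.preimage_mono (Set.Icc_subset_Icc (inv_anti₀ (zero_lt_one.trans_le hM) hMM) hMM)

/-- If the truncated label does not vanish, then all its moments are positive. -/
lemma truncMoment_pos [IsProbabilityMeasure P₀]
    (hξ_meas : ∀ i j, Measurable (ξ i j)) {M : ℝ} (hM : 1 ≤ M) {t₀ : ℝ}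
    {i j : Fin b} (h : 0 < truncMoment P₀ ξ M t₀ i j) (t : ℝ) :
    0 < truncMoment P₀ ξ M t i j := by
  refine mgf_pos' (fun h0 => ?_) (integrable_exp_mul_log_truncated hξ_meas hM t i j)
  rw [truncMoment, Matrix.of_apply, h0, mgf, integral_zero_measure] at h
  exact lt_irrefl 0 h

lemma tendsto_truncMoment (hξ_meas : ∀ i j, Measurable (ξ i j))
    (hξ_pos : ∀ i j, ∀ᵐ ω ∂P₀, 0 < ξ i j ω) {s : ℝ} (hs : s ∈ finiteMoments P₀ ξ) (i j : Fin b) :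
    Tendsto (fun n : ℕ => truncMoment P₀ ξ (n + 1) s i j) atTop
      (𝓝 (moment P₀ ξ s i j).toReal) := by
  have hpow : ∀ᵐ ω ∂P₀, ξ i j ω ^ s = Real.exp (s * Real.log (ξ i j ω)) := by
    filter_upwards [hξ_pos i j] with ω hω
    rw [Real.rpow_def_of_pos hω, mul_comm]
  have hpow0 : ∀ᵐ ω ∂P₀, 0 ≤ ξ i j ω ^ s := by
    filter_upwards [hξ_pos i j] with ω hω
    exact Real.rpow_nonneg hω.le s
  have hint : Integrable (fun ω => ξ i j ω ^ s) P₀ :=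
    (lintegral_ofReal_ne_top_iff_integrable ((hξ_meas i j).pow_const s).aestronglyMeasurable
      hpow0).1 (hs i j).ne
  have hint' := hint.congr hpow
  have hmom : (moment P₀ ξ s i j).toReal = ∫ ω, Real.exp (s * Real.log (ξ i j ω)) ∂P₀ := by
    rw [moment, ← integral_eq_lintegral_of_nonneg_ae hpow0
      ((hξ_meas i j).pow_const s).aestronglyMeasurable, integral_congr_ae hpow]
  have h1 := tendsto_setIntegral_of_monotone (μ := P₀)
    (s := fun n : ℕ => ξ i j ⁻¹' Set.Icc ((n : ℝ) + 1)⁻¹ (n + 1))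
    (f := fun ω => Real.exp (s * Real.log (ξ i j ω)))
    (fun n => hξ_meas i j measurableSet_Icc) (fun n m hnm => ?_) hint'.integrableOn
  · refine h1.congr' (Eventually.of_forall fun n => rfl) |>.trans (le_of_eq ?_)
    rw [hmom, ← setIntegral_univ (μ := P₀)]
    congr 1
    refine setIntegral_congr_set ?_
    filter_upwards [hξ_pos i j] with ω hω
    refine propext ⟨fun _ => trivial, fun _ => ?_⟩
    obtain ⟨n, hn⟩ := exists_nat_ge (max (ξ i j ω) (ξ i j ω)⁻¹)
    refine Set.mem_iUnion.2 ⟨n, ?_, ?_⟩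
    · refine inv_le_of_inv_le₀ hω ?_
      linarith [le_max_right (ξ i j ω) (ξ i j ω)⁻¹]
    · change ξ i j ω ≤ n + 1
      linarith [le_max_left (ξ i j ω) (ξ i j ω)⁻¹]
  · have hnm' : (n : ℝ) + 1 ≤ m + 1 := by
      have : (n : ℝ) ≤ m := by exact_mod_cast hnm
      linarith
    exact Set.preimage_mono (Set.Icc_subset_Icc (inv_anti₀ (by positivity) hnm') hnm')

/-- If the largest eigenvalue of the matrix of moments exceeds one for all orders in `[0, 1]`, then
this persists after truncation at a suitable level, which does not depend on the order. -/
lemma exists_truncation [NeZero b] [IsProbabilityMeasure P₀] (hξ_meas : ∀ i j, Measurable (ξ i j))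
    (hξ_pos : ∀ i j, ∀ᵐ ω ∂P₀, 0 < ξ i j ω) (hD : Set.Icc (0 : ℝ) 1 ⊆ finiteMoments P₀ ξ)
    (h : 1 < lambdaOne P₀ ξ) :
    ∃ M : ℝ, 1 ≤ M ∧ (∀ t i j, 0 < truncMoment P₀ ξ M t i j) ∧
      ∀ s ∈ Set.Icc (0 : ℝ) 1, ∃ u : Fin b → ℝ, (∀ i, 0 < u i) ∧
        ∀ i, u i < (truncMoment P₀ ξ M s).mulVec u i := by
  have hmono : ∀ {M M' : ℝ}, 1 ≤ M → M ≤ M' → ∀ s, (∃ u : Fin b → ℝ, (∀ i, 0 < u i) ∧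
        ∀ i, u i < (truncMoment P₀ ξ M s).mulVec u i) → ∃ u : Fin b → ℝ, (∀ i, 0 < u i) ∧
        ∀ i, u i < (truncMoment P₀ ξ M' s).mulVec u i := by
    rintro M M' hM hMM s ⟨u, hu, hMu⟩
    refine ⟨u, hu, fun i => (hMu i).trans_le ?_⟩
    simp only [Matrix.mulVec, dotProduct]
    refine Finset.sum_le_sum fun j _ => ?_
    exact mul_le_mul_of_nonneg_right (truncMoment_mono hξ_meas hM hMM s i j) (hu j).le
  obtain ⟨M₁, hM₁, h₁⟩ : ∃ M : ℝ, 1 ≤ M ∧ ∀ s ∈ Set.Icc (0 : ℝ) 1, ∃ u : Fin b → ℝ,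
      (∀ i, 0 < u i) ∧ ∀ i, u i < (truncMoment P₀ ξ M s).mulVec u i := by
    refine isCompact_Icc.induction_on (p := fun T : Set ℝ => ∃ M : ℝ, 1 ≤ M ∧ ∀ s ∈ T,
      ∃ u : Fin b → ℝ, (∀ i, 0 < u i) ∧ ∀ i, u i < (truncMoment P₀ ξ M s).mulVec u i)
      ⟨1, le_rfl, by simp⟩ ?_ ?_ ?_
    · rintro T T' hTT ⟨M, hM, hT⟩
      exact ⟨M, hM, fun s hs => hT s (hTT hs)⟩
    · rintro T T' ⟨M, hM, hT⟩ ⟨M', hM', hT'⟩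
      refine ⟨max M M', hM.trans (le_max_left _ _), fun s hs => ?_⟩
      rcases hs with hs | hs
      · exact hmono hM (le_max_left _ _) s (hT s hs)
      · exact hmono hM' (le_max_right _ _) s (hT' s hs)
    · intro s hs
      obtain ⟨r, x, hx, hrho, hAx⟩ := exists_eigenvector_moment hξ_meas hξ_pos (hD hs)
      have hr : 1 < r := by
        have h2 : 1 < rho P₀ ξ s := h.trans_le (iInf₂_le s hs)
        rw [hrho] at h2
        simpa using h2
      have hlim : ∀ᶠ n : ℕ in atTop, ∀ i, x i < (truncMoment P₀ ξ (n + 1) s).mulVec x i := by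
        rw [eventually_all]
        intro i
        have h3 : Tendsto (fun n : ℕ => (truncMoment P₀ ξ (n + 1) s).mulVec x i) atTop
            (𝓝 (r * x i)) := by
          rw [← hAx i]
          exact tendsto_finsetSum _ fun j _ =>
            (tendsto_truncMoment hξ_meas hξ_pos (hD hs) i j).mul_const _
        exact h3.eventually (lt_mem_nhds (lt_mul_of_one_lt_left (hx i) hr))
      obtain ⟨n, hn⟩ := hlim.exists
      have hM : (1 : ℝ) ≤ n + 1 := by linarith [Nat.cast_nonneg (α := ℝ) n]
      have hev : ∀ᶠ s' in 𝓝 s, ∀ i, x i < (truncMoment P₀ ξ (n + 1) s').mulVec x i := by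
        rw [eventually_all]
        intro i
        have hc : ContinuousAt (fun s' => (truncMoment P₀ ξ (n + 1) s').mulVec x i) s := by
          simp only [Matrix.mulVec, dotProduct]
          exact tendsto_finsetSum _ fun j _ =>
            (hasDerivAt_truncMoment hξ_meas hM s i j).continuousAt.mul continuousAt_const
        exact hc.eventually (lt_mem_nhds (hn i))
      exact ⟨_, mem_nhdsWithin_of_mem_nhds hev, n + 1, hM, fun s' hs' => ⟨x, hx, hs'⟩⟩
  have h0 : (0 : ℝ) ∈ finiteMoments P₀ ξ := hD ⟨le_rfl, zero_le_one⟩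
  have hpos : ∀ᶠ n : ℕ in atTop, ∀ i j, 0 < truncMoment P₀ ξ (n + 1) 0 i j := by
    rw [eventually_all]; intro i
    rw [eventually_all]; intro j
    refine (tendsto_truncMoment hξ_meas hξ_pos h0 i j).eventually (lt_mem_nhds ?_)
    exact ENNReal.toReal_pos (moment_pos hξ_meas hξ_pos 0 i j).ne' (h0 i j).ne
  obtain ⟨n, hn⟩ := hpos.exists
  have hM₀ : (1 : ℝ) ≤ n + 1 := by linarith [Nat.cast_nonneg (α := ℝ) n]
  refine ⟨max M₁ (n + 1), hM₁.trans (le_max_left _ _), fun t i j => ?_, fun s hs =>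
    hmono hM₁ (le_max_left _ _) s (h₁ s hs)⟩
  exact truncMoment_pos hξ_meas (hM₁.trans (le_max_left _ _))
    ((hn i j).trans_le (truncMoment_mono hξ_meas hM₀ (le_max_right _ _) 0 i j)) t

end Truncation

/-! ### Good blocks -/


section GoodBlocks

open Filter Topology

variable {b : ℕ} {Ω₀ Ω : Type*} [MeasurableSpace Ω₀] [MeasurableSpace Ω]

/-- The weight `z ^ s` of a block of edges with label product `z`, restricted to blocks which are
good: the product is at most `H` (a condition which is needed only for `0 < s`), and at least `H⁻¹`
(which is needed only for `s < 1`). -/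
noncomputable def goodWeight (s H z : ℝ) : ℝ≥0∞ :=
  {z : ℝ | (0 < s → z ≤ H) ∧ (s < 1 → H⁻¹ ≤ z)}.indicator (posPow s) z

lemma measurable_goodWeight (s H : ℝ) : Measurable (goodWeight s H) := by
  refine (measurable_posPow s).indicator ?_
  refine MeasurableSet.inter (s₁ := {z : ℝ | 0 < s → z ≤ H}) (s₂ := {z : ℝ | s < 1 → H⁻¹ ≤ z})
    ?_ ?_
  · by_cases h : 0 < s
    · simp only [h, forall_const]; exact measurableSet_Iic
    · simp [h]
  · by_cases h : s < 1
    · simp only [h, forall_const]; exact measurableSet_Ici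
    · simp [h]

lemma goodWeight_le {s H : ℝ} (hs : s ∈ Set.Icc (0 : ℝ) 1) (hH : 1 ≤ H) (z : ℝ) :
    goodWeight s H z ≤ ENNReal.ofReal H := by
  refine Set.indicator_apply_le' (fun hz => ?_) fun _ => zero_le
  rw [posPow]
  split_ifs with h0
  · refine ENNReal.ofReal_le_ofReal ?_
    rcases hs.1.eq_or_lt with rfl | hs0
    · simpa using hH
    · calc z ^ s ≤ H ^ s := Real.rpow_le_rpow h0.le (hz.1 hs0) hs.1
        _ ≤ H ^ (1 : ℝ) := Real.rpow_le_rpow_of_exponent_le hH hs.2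
        _ = H := Real.rpow_one H
  · exact zero_le

lemma goodWeight_le_mul {s H : ℝ} (hs : s ∈ Set.Icc (0 : ℝ) 1) (hH : 1 ≤ H) (z : ℝ) :
    goodWeight s H z ≤ ENNReal.ofReal H * ENNReal.ofReal z := by
  have hH0 : 0 < H := zero_lt_one.trans_le hH
  refine Set.indicator_apply_le' (fun hz => ?_) fun _ => zero_le
  rw [posPow, ← ENNReal.ofReal_mul hH0.le]
  split_ifs with h0
  · refine ENNReal.ofReal_le_ofReal ?_
    rcases hs.2.eq_or_lt with rfl | hs1
    · rw [Real.rpow_one]; exact le_mul_of_one_le_left h0.le hH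
    · have hz' : z⁻¹ ≤ H := inv_le_of_inv_le₀ hH0 (hz.2 hs1)
      calc z ^ s = (z⁻¹) ^ (1 - s) * z := by
            rw [Real.inv_rpow h0.le, ← Real.rpow_neg h0.le]
            nth_rewrite 3 [← Real.rpow_one z]
            rw [← Real.rpow_add h0]; congr 1; ring
        _ ≤ H * z := by
            refine mul_le_mul_of_nonneg_right ?_ h0.le
            calc (z⁻¹) ^ (1 - s) ≤ H ^ (1 - s) :=
                  Real.rpow_le_rpow (inv_nonneg.2 h0.le) hz' (by linarith)
              _ ≤ H ^ (1 : ℝ) := Real.rpow_le_rpow_of_exponent_le hH (by linarith [hs.1])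
              _ = H := Real.rpow_one H
  · exact zero_le

/-- The weight of a block which fails to be good because its label product is too large. -/
noncomputable def upperTail (s H z : ℝ) : ℝ≥0∞ := {z : ℝ | 0 < s ∧ H < z}.indicator (posPow s) z

/-- The weight of a block which fails to be good because its label product is too small. -/
noncomputable def lowerTail (s H z : ℝ) : ℝ≥0∞ := {z : ℝ | s < 1 ∧ z < H⁻¹}.indicator (posPow s) z

lemma measurable_upperTail (s H : ℝ) : Measurable (upperTail s H) :=
  (measurable_posPow s).indicator ((MeasurableSet.const _).inter measurableSet_Ioi)

lemma measurable_lowerTail (s H : ℝ) : Measurable (lowerTail s H) :=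
  (measurable_posPow s).indicator ((MeasurableSet.const _).inter measurableSet_Iio)

lemma posPow_le_goodWeight_add (s H z : ℝ) :
    posPow s z ≤ goodWeight s H z + upperTail s H z + lowerTail s H z := by
  by_cases h1 : 0 < s ∧ H < z
  · rw [upperTail, Set.indicator_of_mem (by exact h1)]
    exact le_add_right le_add_self
  by_cases h2 : s < 1 ∧ z < H⁻¹
  · rw [lowerTail, Set.indicator_of_mem (by exact h2)]
    exact le_add_self
  · rw [goodWeight, Set.indicator_of_mem, add_assoc]
    · exact le_self_add
    · exact ⟨fun h => not_lt.1 fun h' => h1 ⟨h, h'⟩, fun h => not_lt.1 fun h' => h2 ⟨h, h'⟩⟩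

lemma upperTail_le {s H δ : ℝ} (hH : 0 < H) (hδ : 0 < δ) (z : ℝ) :
    upperTail s H z ≤ ENNReal.ofReal (H ^ (-δ)) * posPow (s + δ) z := by
  refine Set.indicator_apply_le' (fun hz => ?_) fun _ => zero_le
  have h0 : 0 < z := hH.trans hz.2
  rw [posPow, posPow, if_pos h0, if_pos h0, ← ENNReal.ofReal_mul (Real.rpow_nonneg hH.le _)]
  refine ENNReal.ofReal_le_ofReal ?_
  calc z ^ s = z ^ (-δ) * z ^ (s + δ) := by rw [← Real.rpow_add h0]; congr 1; ring
    _ ≤ _ := mul_le_mul_of_nonneg_right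
      (Real.rpow_le_rpow_of_nonpos hH hz.2.le (by linarith)) (Real.rpow_nonneg h0.le _)

lemma lowerTail_le {s H δ : ℝ} (hH : 0 < H) (hδ : 0 < δ) (z : ℝ) :
    lowerTail s H z ≤ ENNReal.ofReal (H ^ (-δ)) * posPow (s - δ) z := by
  refine Set.indicator_apply_le' (fun hz => ?_) fun _ => zero_le
  rw [posPow, posPow]
  split_ifs with h0
  · rw [← ENNReal.ofReal_mul (Real.rpow_nonneg hH.le _)]
    refine ENNReal.ofReal_le_ofReal ?_
    calc z ^ s = z ^ δ * z ^ (s - δ) := by rw [← Real.rpow_add h0]; congr 1; ring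
      _ ≤ H ^ (-δ) * z ^ (s - δ) := by
        refine mul_le_mul_of_nonneg_right ?_ (Real.rpow_nonneg h0.le _)
        rw [Real.rpow_neg hH.le, ← Real.inv_rpow hH.le]
        exact Real.rpow_le_rpow h0.le hz.2.le hδ.le
  · exact zero_le

variable {P₀ : Measure Ω₀} [IsProbabilityMeasure P₀] {ξ : Fin b → Fin b → Ω₀ → ℝ}
  {ζ : Vertex b → Fin b → Ω → ℝ}

lemma measurable_pathWeight_truncLabel (hζ : ∀ u i, Measurable (ζ u i)) (M : ℝ)
    (p v : Vertex b) :
    Measurable fun ω => pathWeight (fun u i => truncLabel M (ζ u i ω)) p v :=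
  measurable_pathWeight (fun u i => (measurable_truncLabel M).comp (hζ u i)) p v

/-- Sums of the moments of order `t` over the paths of length `k` are governed by a subinvariant
vector `u` of the matrix of moments; comparing with another positive vector `x` costs a constant. -/
lemma exists_sum_posPow_le (hξ : ∀ i j, Measurable (ξ i j)) (hζ : ∀ u i, Measurable (ζ u i))
    {M : ℝ} (hM : 1 ≤ M) {t τ : ℝ} (hτ : 0 ≤ τ) {u x : Fin b → ℝ} (hu : ∀ i, 0 < u i)
    (hx : ∀ i, 0 < x i) (hA : ∀ i, (truncMoment P₀ ξ M t).mulVec u i ≤ τ * u i)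
    (hA0 : ∀ i j, 0 < truncMoment P₀ ξ M t i j) :
    ∃ C : ℝ, 0 ≤ C ∧ ∀ (Q : Measure Ω) (g : Vertex b → Fin b) (N k : ℕ) (v : Vertex b),
      IsProper g → IsQuenched P₀ ξ Q g N ζ → k + v.length ≤ N →
      ∑ p ∈ words (Fin b) k,
        (∫⁻ ω, posPow t (pathWeight (fun u i => truncLabel M (ζ u i ω)) p v) ∂Q) *
          ENNReal.ofReal (x (g (p ++ v))) ≤ ENNReal.ofReal (C * τ ^ k) * ENNReal.ofReal (x (g v)) := by
  set c₁ : ℝ := ∑ i, x i / u i with hc₁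
  set c₂ : ℝ := ∑ i, u i / x i with hc₂
  have hc₁0 : 0 ≤ c₁ := Finset.sum_nonneg fun i _ => (div_pos (hx i) (hu i)).le
  have hc₂0 : 0 ≤ c₂ := Finset.sum_nonneg fun i _ => (div_pos (hu i) (hx i)).le
  have h₁ : ∀ i, x i ≤ c₁ * u i := fun i => by
    rw [← div_le_iff₀ (hu i)]
    exact Finset.single_le_sum (f := fun i => x i / u i)
      (fun i _ => (div_pos (hx i) (hu i)).le) (Finset.mem_univ i)
  have h₂ : ∀ i, u i ≤ c₂ * x i := fun i => by
    rw [← div_le_iff₀ (hx i)]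
    exact Finset.single_le_sum (f := fun i => u i / x i)
      (fun i _ => (div_pos (hu i) (hx i)).le) (Finset.mem_univ i)
  refine ⟨c₁ * c₂, mul_nonneg hc₁0 hc₂0, fun Q g N k v hg hq hv => ?_⟩
  have h3 := hq.sum_lintegral_pathWeight_le hξ hg hζ
    (F := fun z => posPow t (truncLabel M z)) ((measurable_posPow t).comp (measurable_truncLabel M))
    (y := fun i => ENNReal.ofReal (u i)) (t := ENNReal.ofReal τ) (fun i => ?_) k hv
  · calc _ ≤ ∑ p ∈ words (Fin b) k, ENNReal.ofReal c₁ *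
          ((∫⁻ ω, pathWeight (fun u i => posPow t (truncLabel M (ζ u i ω))) p v ∂Q) *
          ENNReal.ofReal (u (g (p ++ v)))) := by
          refine Finset.sum_le_sum fun p _ => ?_
          simp_rw [posPow_pathWeight fun u i => truncLabel_nonneg hM _]
          rw [mul_left_comm, ← ENNReal.ofReal_mul hc₁0]
          exact mul_le_mul_right (ENNReal.ofReal_le_ofReal (h₁ _)) _
      _ ≤ ENNReal.ofReal c₁ * (ENNReal.ofReal τ ^ k * ENNReal.ofReal (u (g v))) := by
          rw [← Finset.mul_sum]
          exact mul_le_mul_right h3 _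
      _ ≤ ENNReal.ofReal c₁ * (ENNReal.ofReal τ ^ k * ENNReal.ofReal (c₂ * x (g v))) := by
          gcongr
          exact h₂ _
      _ = _ := by
          rw [ENNReal.ofReal_mul (mul_nonneg hc₁0 hc₂0), ENNReal.ofReal_mul hc₁0,
            ENNReal.ofReal_mul hc₂0, ENNReal.ofReal_pow hτ]
          ring
  · rw [← ENNReal.ofReal_mul hτ]
    refine le_trans (le_of_eq ?_) (ENNReal.ofReal_le_ofReal (hA i))
    simp only [Matrix.mulVec, dotProduct]
    rw [ENNReal.ofReal_sum_of_nonneg fun j _ => mul_nonneg (hA0 i j).le (hu j).le]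
    refine Finset.sum_congr rfl fun j _ => ?_
    rw [lintegral_posPow_truncLabel hξ hM, ENNReal.ofReal_mul (hA0 i j).le]

/-- The main estimate: for a suitable order `s`, truncation level `M` and block length `k`, the
number of good blocks below a vertex, weighted by the label products to the power `s`, has a mean
which exceeds the bound `H` of the weights by a factor of two. -/
lemma exists_good_blocks [NeZero b] (hξ : ∀ i j, Measurable (ξ i j))
    (hξ_pos : ∀ i j, ∀ᵐ ω ∂P₀, 0 < ξ i j ω) (hD : Set.Icc (0 : ℝ) 1 ⊆ finiteMoments P₀ ξ)
    (h : 1 < lambdaOne P₀ ξ) (hζ : ∀ u i, Measurable (ζ u i)) :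
    ∃ s ∈ Set.Icc (0 : ℝ) 1, ∃ M ≥ (1 : ℝ), ∃ H ≥ (1 : ℝ), ∃ k > (0 : ℕ), ∃ x : Fin b → ℝ,
      (∀ i, 0 < x i) ∧ ∀ (Q : Measure Ω) (g : Vertex b → Fin b) (N : ℕ) (v : Vertex b),
      IsProper g → IsQuenched P₀ ξ Q g N ζ → k + v.length ≤ N →
      2 * ENNReal.ofReal H * ENNReal.ofReal (x (g v)) ≤ ∑ p ∈ words (Fin b) k,
        (∫⁻ ω, goodWeight s H (pathWeight (fun u i => truncLabel M (ζ u i ω)) p v) ∂Q) *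
          ENNReal.ofReal (x (g (p ++ v))) := by
  obtain ⟨M, hM, hpos, hgrow⟩ := exists_truncation hξ hξ_pos hD h
  obtain ⟨s, hs, r, hr, x, hx, hAx, hup, hlow⟩ :=
    exists_minimiser (hasDerivAt_truncMoment hξ hM) hpos hgrow
  have hr0 : 0 < r := zero_lt_one.trans hr
  -- Any rate `ε` with `0 < ε < log r` can be taken.
  set ε : ℝ := Real.log r / 2 with hε
  have hlog : 0 < Real.log r := Real.log_pos hr
  have hε0 : 0 < ε := by rw [hε]; linarith
  have hεr : Real.exp ε < r := by
    rw [← Real.lt_log_iff_exp_lt hr0, hε]; linarith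
  have hrate : ∀ δ > 0, (r + ε * δ) * Real.exp (-(ε * δ)) < r := by
    intro δ hδ
    rw [Real.exp_neg, ← div_eq_mul_inv, div_lt_iff₀ (Real.exp_pos _)]
    have h1 : 0 < ε * δ := mul_pos hε0 hδ
    nlinarith [Real.add_one_le_exp (ε * δ)]
  have hHpow : ∀ (k : ℕ) (δ : ℝ), Real.exp (ε * k) ^ (-δ) = Real.exp (-(ε * δ)) ^ k := by
    intro k δ
    rw [← Real.exp_mul, ← Real.exp_nat_mul]; congr 1; ring
  -- Both tails are exponentially smaller than `r ^ k`.
  have htail : ∀ (T : ℝ → ℝ → ℝ≥0∞) (t δ : ℝ), 0 < δ → (∃ u : Fin b → ℝ, (∀ i, 0 < u i) ∧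
        ∀ i, (truncMoment P₀ ξ M t).mulVec u i ≤ (r + ε * δ) * u i) →
      (∀ H z, 0 < H → T H z ≤ ENNReal.ofReal (H ^ (-δ)) * posPow t z) →
      ∃ C θ : ℝ, 0 ≤ C ∧ 0 ≤ θ ∧ θ < r ∧
        ∀ (Q : Measure Ω) (g : Vertex b → Fin b) (N k : ℕ) (v : Vertex b),
        IsProper g → IsQuenched P₀ ξ Q g N ζ → k + v.length ≤ N →
        ∑ p ∈ words (Fin b) k, (∫⁻ ω, T (Real.exp (ε * k))
          (pathWeight (fun u i => truncLabel M (ζ u i ω)) p v) ∂Q) *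
          ENNReal.ofReal (x (g (p ++ v))) ≤ ENNReal.ofReal (C * θ ^ k) * ENNReal.ofReal (x (g v)) := by
    rintro T t δ hδ ⟨u, hu, hAu⟩ hT
    have hτ : 0 ≤ r + ε * δ := by positivity
    obtain ⟨C, hC, hsum⟩ := exists_sum_posPow_le hξ hζ hM hτ hu hx hAu (hpos t)
    refine ⟨C, (r + ε * δ) * Real.exp (-(ε * δ)), hC, by positivity, hrate δ hδ,
      fun Q g N k v hg hq hv => ?_⟩
    calc _ ≤ ∑ p ∈ words (Fin b) k, ENNReal.ofReal (Real.exp (ε * k) ^ (-δ)) *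
          ((∫⁻ ω, posPow t (pathWeight (fun u i => truncLabel M (ζ u i ω)) p v) ∂Q) *
          ENNReal.ofReal (x (g (p ++ v)))) := by
          refine Finset.sum_le_sum fun p _ => ?_
          have hm : Measurable fun ω =>
              posPow t (pathWeight (fun u i => truncLabel M (ζ u i ω)) p v) :=
            (measurable_posPow t).comp (measurable_pathWeight_truncLabel hζ M p v)
          rw [← mul_assoc, ← lintegral_const_mul _ hm]
          exact mul_le_mul_left (lintegral_mono fun ω => hT _ _ (Real.exp_pos _)) _
      _ ≤ ENNReal.ofReal (Real.exp (ε * k) ^ (-δ)) *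
          (ENNReal.ofReal (C * (r + ε * δ) ^ k) * ENNReal.ofReal (x (g v))) := by
          rw [← Finset.mul_sum]
          exact mul_le_mul_right (hsum Q g N k v hg hq hv) _
      _ = _ := by
          rw [← mul_assoc, ← ENNReal.ofReal_mul (by positivity), hHpow, mul_pow]
          congr 2; ring
  obtain ⟨C₁, θ₁, hC₁, hθ₁, hθ₁r, hU⟩ : ∃ C θ : ℝ, 0 ≤ C ∧ 0 ≤ θ ∧ θ < r ∧
        ∀ (Q : Measure Ω) (g : Vertex b → Fin b) (N k : ℕ) (v : Vertex b),
        IsProper g → IsQuenched P₀ ξ Q g N ζ → k + v.length ≤ N →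
        ∑ p ∈ words (Fin b) k, (∫⁻ ω, upperTail s (Real.exp (ε * k))
          (pathWeight (fun u i => truncLabel M (ζ u i ω)) p v) ∂Q) *
          ENNReal.ofReal (x (g (p ++ v))) ≤
            ENNReal.ofReal (C * θ ^ k) * ENNReal.ofReal (x (g v)) := by
    by_cases hs0 : 0 < s
    · obtain ⟨δ, hδ, hu⟩ := hup hs0 ε hε0
      exact htail (upperTail s) (s + δ) δ hδ hu fun H z hH => upperTail_le hH hδ z
    · exact ⟨0, 0, le_rfl, le_rfl, hr0, fun Q g N k v _ _ _ => by simp [upperTail, hs0]⟩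
  obtain ⟨C₂, θ₂, hC₂, hθ₂, hθ₂r, hL⟩ : ∃ C θ : ℝ, 0 ≤ C ∧ 0 ≤ θ ∧ θ < r ∧
        ∀ (Q : Measure Ω) (g : Vertex b → Fin b) (N k : ℕ) (v : Vertex b),
        IsProper g → IsQuenched P₀ ξ Q g N ζ → k + v.length ≤ N →
        ∑ p ∈ words (Fin b) k, (∫⁻ ω, lowerTail s (Real.exp (ε * k))
          (pathWeight (fun u i => truncLabel M (ζ u i ω)) p v) ∂Q) *
          ENNReal.ofReal (x (g (p ++ v))) ≤
            ENNReal.ofReal (C * θ ^ k) * ENNReal.ofReal (x (g v)) := by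
    by_cases hs1 : s < 1
    · obtain ⟨δ, hδ, hu⟩ := hlow hs1 ε hε0
      exact htail (lowerTail s) (s - δ) δ hδ hu fun H z hH => lowerTail_le hH hδ z
    · exact ⟨0, 0, le_rfl, le_rfl, hr0, fun Q g N k v _ _ _ => by simp [lowerTail, hs1]⟩
  obtain ⟨k, hk0, hk⟩ : ∃ k > (0 : ℕ),
      C₁ * θ₁ ^ k + C₂ * θ₂ ^ k + 2 * Real.exp (ε * k) ≤ r ^ k := by
    have hlim : ∀ (C θ : ℝ), 0 ≤ θ → θ < r →
        Tendsto (fun k : ℕ => C * (θ / r) ^ k) atTop (𝓝 0) := by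
      intro C θ h0 h1
      simpa using (tendsto_pow_atTop_nhds_zero_of_lt_one (div_nonneg h0 hr0.le)
        ((div_lt_one hr0).2 h1)).const_mul C
    have h1 := ((hlim C₁ θ₁ hθ₁ hθ₁r).add (hlim C₂ θ₂ hθ₂ hθ₂r)).add
      (hlim 2 (Real.exp ε) (Real.exp_pos _).le hεr)
    rw [add_zero, add_zero] at h1
    obtain ⟨k, hk, hk0⟩ := ((h1.eventually (gt_mem_nhds one_pos)).and (eventually_gt_atTop 0)).exists
    refine ⟨k, hk0, ?_⟩
    have hrk : 0 < r ^ k := pow_pos hr0 k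
    have h2 : Real.exp (ε * k) = Real.exp ε ^ k := by rw [← Real.exp_nat_mul, mul_comm]
    rw [h2]
    have h3 : (C₁ * (θ₁ / r) ^ k + C₂ * (θ₂ / r) ^ k + 2 * (Real.exp ε / r) ^ k) * r ^ k
        = C₁ * θ₁ ^ k + C₂ * θ₂ ^ k + 2 * Real.exp ε ^ k := by
      simp only [div_pow]; field_simp
    rw [← h3]
    exact mul_le_of_le_one_left hrk.le hk.le
  have hH : 1 ≤ Real.exp (ε * k) := Real.one_le_exp (by positivity)
  refine ⟨s, hs, M, hM, Real.exp (ε * k), hH, k, hk0, x, hx, fun Q g N v hg hq hv => ?_⟩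
  set H : ℝ := Real.exp (ε * k) with hHdef
  have htotal : ∑ p ∈ words (Fin b) k,
      (∫⁻ ω, posPow s (pathWeight (fun u i => truncLabel M (ζ u i ω)) p v) ∂Q) *
        ENNReal.ofReal (x (g (p ++ v))) = ENNReal.ofReal (r ^ k) * ENNReal.ofReal (x (g v)) := by
    have h3 := hq.sum_lintegral_pathWeight hξ hg hζ
      (F := fun z => posPow s (truncLabel M z))
      ((measurable_posPow s).comp (measurable_truncLabel M))
      (y := fun i => ENNReal.ofReal (x i)) (t := ENNReal.ofReal r) (fun i => ?_) k hv
    · simp_rw [posPow_pathWeight fun u i => truncLabel_nonneg hM _]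
      rw [h3, ENNReal.ofReal_pow hr0.le]
    · have h4 : (truncMoment P₀ ξ M s).mulVec x i = r * x i := congrFun hAx i
      rw [← ENNReal.ofReal_mul hr0.le, ← h4]
      simp only [Matrix.mulVec, dotProduct]
      rw [ENNReal.ofReal_sum_of_nonneg fun j _ => mul_nonneg (hpos s i j).le (hx j).le]
      refine Finset.sum_congr rfl fun j _ => ?_
      rw [lintegral_posPow_truncLabel hξ hM, ENNReal.ofReal_mul (hpos s i j).le]
  have hU' := hU Q g N k v hg hq hv
  have hL' := hL Q g N k v hg hq hv
  have hsplit : ∑ p ∈ words (Fin b) k,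
      (∫⁻ ω, posPow s (pathWeight (fun u i => truncLabel M (ζ u i ω)) p v) ∂Q) *
        ENNReal.ofReal (x (g (p ++ v))) ≤
      (∑ p ∈ words (Fin b) k,
        (∫⁻ ω, goodWeight s H (pathWeight (fun u i => truncLabel M (ζ u i ω)) p v) ∂Q) *
          ENNReal.ofReal (x (g (p ++ v)))) +
      (ENNReal.ofReal (C₁ * θ₁ ^ k) * ENNReal.ofReal (x (g v)) +
        ENNReal.ofReal (C₂ * θ₂ ^ k) * ENNReal.ofReal (x (g v))) := by
    refine le_trans ?_ (add_le_add le_rfl (add_le_add hU' hL'))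
    rw [← Finset.sum_add_distrib, ← Finset.sum_add_distrib]
    refine Finset.sum_le_sum fun p _ => ?_
    have hm := measurable_pathWeight_truncLabel hζ M p v
    have hmU : Measurable fun ω =>
        upperTail s H (pathWeight (fun u i => truncLabel M (ζ u i ω)) p v) :=
      (measurable_upperTail s H).comp hm
    have hmL : Measurable fun ω =>
        lowerTail s H (pathWeight (fun u i => truncLabel M (ζ u i ω)) p v) :=
      (measurable_lowerTail s H).comp hm
    rw [← add_mul, ← add_mul, ← add_assoc, ← lintegral_add_right _ hmU,
      ← lintegral_add_right _ hmL]
    exact mul_le_mul_left (lintegral_mono fun ω => posPow_le_goodWeight_add _ _ _) _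
  rw [htotal] at hsplit
  have hfin : ENNReal.ofReal (C₁ * θ₁ ^ k) * ENNReal.ofReal (x (g v)) +
      ENNReal.ofReal (C₂ * θ₂ ^ k) * ENNReal.ofReal (x (g v)) ≠ ∞ := by finiteness
  refine (ENNReal.add_le_add_iff_right hfin).1 (le_trans ?_ hsplit)
  calc _ = ENNReal.ofReal (C₁ * θ₁ ^ k + C₂ * θ₂ ^ k + 2 * H) * ENNReal.ofReal (x (g v)) := by
        rw [ENNReal.ofReal_add (by positivity) (by positivity),
          ENNReal.ofReal_add (by positivity) (by positivity), ENNReal.ofReal_mul zero_le_two]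
        simp only [ENNReal.ofReal_ofNat]
        ring
    _ ≤ _ := mul_le_mul_left (ENNReal.ofReal_le_ofReal hk) _

end GoodBlocks

/-! ### Divergence of the sum -/


section Infinite

open Filter Topology

variable {b : ℕ} {Ω₀ Ω : Type*}

lemma pathWeight_le_pow_mul {ι : Type*} {w w' : List ι → ι → ℝ≥0∞} {H : ℝ≥0∞}
    (h : ∀ u i, w u i ≤ H * w' u i) (q u : List ι) :
    pathWeight w q u ≤ H ^ q.length * pathWeight w' q u := by
  induction q with
  | nil => simp
  | cons i q ih =>
    rw [pathWeight_cons, pathWeight_cons, List.length_cons, pow_succ']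
    calc _ ≤ H * w' (q ++ u) i * (H ^ q.length * pathWeight w' q u) := mul_le_mul' (h _ _) ih
      _ = _ := by ring

lemma pathWeight_le_of_le {ι : Type*} {w w' : List ι → ι → ℝ} (h0 : ∀ u i, 0 ≤ w u i)
    (h : ∀ u i, w u i ≤ w' u i) (q u : List ι) : pathWeight w q u ≤ pathWeight w' q u := by
  induction q with
  | nil => exact le_rfl
  | cons i q ih => exact mul_le_mul (h _ _) ih (pathWeight_nonneg h0 q u) ((h0 _ _).trans (h _ _))

/-- The product of the labels along a sequence of blocks is the product of the block products. -/
lemma ofReal_pathWeight_unblock {k : ℕ} {w : Vertex b → Fin b → ℝ} (h : ∀ u i, 0 ≤ w u i)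
    (q u : List (words (Fin b) k)) :
    ENNReal.ofReal (pathWeight w (unblock (q ++ u)) []) =
      pathWeight (fun U p => ENNReal.ofReal (pathWeight w p.1 (unblock U))) q u *
        ENNReal.ofReal (pathWeight w (unblock u) []) := by
  induction q with
  | nil => simp
  | cons p q ih =>
    rw [pathWeight_cons, List.cons_append, unblock, pathWeight_append,
      ENNReal.ofReal_mul (pathWeight_nonneg h _ _), List.append_nil, ih, mul_assoc]

/-- The sum over all vertices dominates the weighted sums over the good blocks. -/
lemma sum_pathWeight_goodWeight_le {k : ℕ} (hk : 0 < k) {s H M : ℝ} (hs : s ∈ Set.Icc (0 : ℝ) 1)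
    (hH : 1 ≤ H) (hM : 1 ≤ M) {ζ : Vertex b → Fin b → Ω → ℝ} {ω : Ω} (hζ : ∀ u i, 0 < ζ u i ω)
    (m n : ℕ) {α : ℝ≥0∞}
    (hα : ∀ u ∈ words (words (Fin b) k) m, α ≤ ENNReal.ofReal (pathProd ζ ω (unblock u))) :
    α * (∑ u ∈ words (words (Fin b) k) m, ∑ q ∈ words (words (Fin b) k) n,
      pathWeight (fun U p => goodWeight s H
        (pathWeight (fun u i => truncLabel M (ζ u i ω)) p.1 (unblock U))) q u)
      ≤ ENNReal.ofReal H ^ n * totalSum ζ ω := by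
  classical
  set W := words (words (Fin b) k) with hW
  have hinj : Set.InjOn (fun p : List (words (Fin b) k) × List (words (Fin b) k) =>
      unblock (p.2 ++ p.1)) (W m ×ˢ W n : Finset _) := by
    rintro ⟨u, q⟩ hp ⟨u', q'⟩ hp' he
    simp only [hW, Finset.coe_product, Set.mem_prod, Finset.mem_coe, mem_words] at hp hp'
    obtain ⟨h1, h2⟩ := List.append_inj (unblock_injective hk he) (hp.2.trans hp'.2.symm)
    exact Prod.ext h2 h1
  calc _ ≤ ∑ u ∈ W m, ∑ q ∈ W n,
        ENNReal.ofReal H ^ n * ENNReal.ofReal (pathProd ζ ω (unblock (q ++ u))) := by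
        simp_rw [Finset.mul_sum]
        refine Finset.sum_le_sum fun u hu => Finset.sum_le_sum fun q hq => ?_
        rw [pathProd_eq_pathWeight, ofReal_pathWeight_unblock fun u i => (hζ u i).le,
          ← pathProd_eq_pathWeight, mul_comm α, ← mul_assoc]
        refine mul_le_mul' ?_ (hα u hu)
        refine (pathWeight_le_pow_mul (H := ENNReal.ofReal H) (fun U p => ?_) q u).trans
          (le_of_eq (by rw [mem_words.1 hq]))
        refine (goodWeight_le_mul hs hH _).trans (mul_le_mul_right (ENNReal.ofReal_le_ofReal ?_) _)
        exact pathWeight_le_of_le (fun u i => truncLabel_nonneg hM _)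
          (fun u i => truncLabel_le M (hζ u i).le) _ _
    _ = ENNReal.ofReal H ^ n * ∑ v ∈ (W m ×ˢ W n).image fun p => unblock (p.2 ++ p.1),
          ENNReal.ofReal (pathProd ζ ω v) := by
        rw [Finset.sum_image hinj, Finset.sum_product, Finset.mul_sum]
        exact Finset.sum_congr rfl fun u _ => by rw [Finset.mul_sum]
    _ ≤ _ := mul_le_mul_right (ENNReal.sum_le_tsum _) _

/-- If the largest eigenvalue of the matrix of moments of order `s` exceeds one for all `s ∈ [0, 1]`,
then the sum is infinite: by the second moment method for good blocks below the vertices of a given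
level, the probability of a finite sum is small, and it tends to zero with the level. -/
theorem ae_totalSum_eq_top [MeasurableSpace Ω₀] [MeasurableSpace Ω] (hb : 2 ≤ b) {P₀ : Measure Ω₀} [IsProbabilityMeasure P₀]
    {ξ : Fin b → Fin b → Ω₀ → ℝ} (hξ_meas : ∀ i j, Measurable (ξ i j))
    (hξ_pos : ∀ i j, ∀ᵐ ω ∂P₀, 0 < ξ i j ω) (hD : Set.Icc (0 : ℝ) 1 ⊆ finiteMoments P₀ ξ)
    {P : Measure Ω} [IsProbabilityMeasure P]
    {c : Ω → Vertex b → Fin b} (hc : Measurable c) (hproper : ∀ᵐ ω ∂P, IsProper (c ω))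
    {ζ : Vertex b → Fin b → Ω → ℝ} (hζ : IsEnvironment P₀ ξ P c ζ) (h : 1 < lambdaOne P₀ ξ) :
    ∀ᵐ ω ∂P, totalSum ζ ω = ∞ := by
  have : NeZero b := ⟨by omega⟩
  obtain ⟨s, hs, M, hM, H, hH, k, hk, x, hx, hgood⟩ :=
    exists_good_blocks hξ_meas hξ_pos hD h hζ.measurable
  have hpos := hζ.ae_pos hξ_pos hc
  -- The blocks form the alphabet of a tree to which the second moment method applies.
  let ι : Type := ↥(words (Fin b) k)
  have : Nonempty ι := ⟨⟨List.replicate k 0, by simp⟩⟩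
  set D : ℕ := Fintype.card ι with hDdef
  have hD2 : 2 ≤ D := by
    have h1 : D = b ^ k := by
      exact (Fintype.card_coe (words (Fin b) k)).trans (by rw [card_words, Fintype.card_fin])
    rw [h1]
    exact hb.trans (Nat.le_self_pow hk.ne' b)
  obtain ⟨i₀, -, hi₀⟩ := Finset.exists_min_image Finset.univ x Finset.univ_nonempty
  obtain ⟨i₁, -, hi₁⟩ := Finset.exists_max_image Finset.univ x Finset.univ_nonempty
  set a : ℝ≥0∞ := ENNReal.ofReal (x i₀) with ha
  set A : ℝ≥0∞ := ENNReal.ofReal (x i₁) with hA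
  have ha0 : a ≠ 0 := by simpa [ha] using hx i₀
  have haA : ∀ i, a ≤ ENNReal.ofReal (x i) ∧ ENNReal.ofReal (x i) ≤ A := fun i =>
    ⟨ENNReal.ofReal_le_ofReal (hi₀ i (Finset.mem_univ i)),
      ENNReal.ofReal_le_ofReal (hi₁ i (Finset.mem_univ i))⟩
  set w : List ι → ι → Ω → ℝ≥0∞ := fun U p ω =>
    goodWeight s H (pathWeight (fun u i => truncLabel M (ζ u i ω)) p.1 (unblock U)) with hw
  have hwm : ∀ U p, Measurable (w U p) := fun U p =>
    (measurable_goodWeight s H).comp (measurable_pathWeight_truncLabel hζ.measurable M _ _)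
  set V : ℕ → ℕ → Ω → ℝ≥0∞ := fun m n ω =>
    ∑ u ∈ words ι m, ∑ q ∈ words ι n, pathWeight (fun U p => w U p ω) q u with hV
  have hVm : ∀ m n, Measurable (V m n) := fun m n =>
    Finset.measurable_sum _ fun u _ => Finset.measurable_sum _ fun q _ =>
      measurable_pathWeight hwm q u
  set F : ℕ → ℕ → Set Ω := fun m n =>
    {ω | A * V m n ω < (2 * ENNReal.ofReal H) ^ n * a / 2} with hF
  have hFm : ∀ m n, MeasurableSet (F m n) := fun m n =>
    measurableSet_lt ((hVm m n).const_mul A) measurable_const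
  have hH1 : 1 ≤ ENNReal.ofReal H := by simpa using ENNReal.ofReal_le_ofReal hH
  have hPF : ∀ m n, P (F m n) * (a ^ 2 * (D : ℝ≥0∞) ^ m) ≤ 4 * (D * A ^ 2) := by
    intro m n
    have hden : a ^ 2 * (D : ℝ≥0∞) ^ m ≠ 0 := by
      have : (D : ℝ≥0∞) ≠ 0 := by exact_mod_cast (by omega : D ≠ 0)
      positivity
    have hden' : a ^ 2 * (D : ℝ≥0∞) ^ m ≠ ∞ := by finiteness
    rw [← ENNReal.le_div_iff_mul_le (Or.inl hden) (Or.inl hden'),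
      ← lintegral_indicator_one (hFm m n)]
    refine lintegral_le_of_isQuenched hξ_meas hc hproper hζ ((n + m) * k)
      fun g Q hg hQ hq => ?_
    rw [lintegral_indicator_one (hFm m n),
      ENNReal.le_div_iff_mul_le (Or.inl hden) (Or.inl hden')]
    refine measure_sum_pathWeight_lt Q
      (hq.hasProductMeans_block hζ.measurable (measurable_truncLabel M)
        (measurable_goodWeight s H) hk) hwm hH1 ENNReal.ofReal_ne_top
      (fun U p ω => goodWeight_le hs hH _) (x := fun U => ENNReal.ofReal (x (g (unblock U))))
      ha0 ENNReal.ofReal_ne_top (fun U => (haA _).1) (fun U => (haA _).2) (fun U hU => ?_) le_rfl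
    refine (hgood Q g _ (unblock U) hg hq ?_).trans (le_of_eq ?_)
    · rw [length_unblock]
      have h1 : (U.length + 1) * k ≤ (n + m) * k := Nat.mul_le_mul_right k hU
      have h2 : (U.length + 1) * k = k + U.length * k := by ring
      omega
    · exact (Finset.sum_coe_sort (words (Fin b) k) fun p =>
        (∫⁻ ω, goodWeight s H (pathWeight (fun u i => truncLabel M (ζ u i ω)) p (unblock U)) ∂Q) *
          ENNReal.ofReal (x (g (p ++ unblock U)))).symm
  -- If the sum is finite, then the events `F m n` occur for all large `n`.
  have hfin : ∀ m, ∀ᵐ ω ∂P, totalSum ζ ω ≠ ∞ → ω ∈ ⋃ n₀, ⋂ n ≥ n₀, F m n := by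
    intro m
    filter_upwards [hpos] with ω hω hY
    obtain ⟨α, hα0, hα⟩ : ∃ α : ℝ≥0∞, α ≠ 0 ∧
        ∀ u ∈ words ι m, α ≤ ENNReal.ofReal (pathProd ζ ω (unblock u)) := by
      refine ⟨(words ι m).inf fun u => ENNReal.ofReal (pathProd ζ ω (unblock u)), ?_,
        fun u hu => Finset.inf_le hu⟩
      refine ((Finset.lt_inf_iff (by simp)).2 fun u _ => ?_).ne'
      rw [pathProd_eq_pathWeight]
      exact ENNReal.ofReal_pos.2 (pathWeight_pos hω _ _)
    obtain ⟨n₀, hn₀⟩ := ENNReal.exists_nat_mul_gt (a := α * a / 2) (b := A * totalSum ζ ω)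
      (by simp [hα0, ha0]) (ENNReal.mul_ne_top ENNReal.ofReal_ne_top hY)
    refine Set.mem_iUnion.2 ⟨n₀, Set.mem_iInter₂.2 fun n hn => ?_⟩
    by_contra hcon
    have h1 : (2 * ENNReal.ofReal H) ^ n * a / 2 ≤ A * V m n ω := not_lt.1 hcon
    have h2 := sum_pathWeight_goodWeight_le hk hs hH hM hω m n hα
    have h3 : ENNReal.ofReal H ^ n * ((n₀ : ℝ≥0∞) * (α * a / 2)) ≤
        ENNReal.ofReal H ^ n * (A * totalSum ζ ω) := by
      calc _ ≤ ENNReal.ofReal H ^ n * ((2 : ℝ≥0∞) ^ n * (α * a / 2)) := by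
            gcongr
            have h4 : n₀ < 2 ^ n := lt_of_le_of_lt hn Nat.lt_two_pow_self
            exact_mod_cast h4.le
        _ = α * ((2 * ENNReal.ofReal H) ^ n * a / 2) := by
            rw [div_eq_mul_inv, div_eq_mul_inv]; ring
        _ ≤ α * (A * V m n ω) := by gcongr
        _ = A * (α * V m n ω) := by ring
        _ ≤ A * (ENNReal.ofReal H ^ n * totalSum ζ ω) := by gcongr
        _ = _ := by ring
    have h5 : ENNReal.ofReal H ^ n ≠ 0 := pow_ne_zero _ (zero_lt_one.trans_le hH1).ne'
    exact absurd hn₀ (not_lt.2 ((ENNReal.mul_le_mul_iff_right h5 (by finiteness)).1 h3))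
  have hbound : ∀ m, P {ω | totalSum ζ ω ≠ ∞} * (a ^ 2 * (D : ℝ≥0∞) ^ m) ≤ 4 * (D * A ^ 2) := by
    intro m
    have hmono : Monotone fun n₀ => ⋂ n ≥ n₀, F m n := fun n₁ n₂ h12 =>
      Set.biInter_subset_biInter_left fun n hn => le_trans h12 hn
    have h1 : P {ω | totalSum ζ ω ≠ ∞} ≤ ⨆ n₀, P (⋂ n ≥ n₀, F m n) := by
      rw [← hmono.measure_iUnion]
      exact measure_mono_ae (hfin m)
    refine (mul_le_mul_left h1 _).trans ?_
    rw [ENNReal.iSup_mul]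
    refine iSup_le fun n₀ => le_trans (mul_le_mul_left (measure_mono ?_) _) (hPF m n₀)
    exact Set.biInter_subset_of_mem (le_refl n₀)
  rw [ae_iff]
  by_contra hne
  obtain ⟨m, hm⟩ := ENNReal.exists_nat_mul_gt (a := P {ω | totalSum ζ ω ≠ ∞} * a ^ 2)
    (b := 4 * (D * A ^ 2)) (mul_ne_zero hne (pow_ne_zero _ ha0)) (by finiteness)
  refine absurd hm (not_lt.2 (le_trans ?_ (hbound m)))
  have h1 : (m : ℝ≥0∞) ≤ (D : ℝ≥0∞) ^ m := by
    have h2 : m ≤ D ^ m := Nat.lt_two_pow_self.le.trans (Nat.pow_le_pow_left hD2 m)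
    exact_mod_cast h2
  calc (m : ℝ≥0∞) * (P {ω | totalSum ζ ω ≠ ∞} * a ^ 2)
      ≤ (D : ℝ≥0∞) ^ m * (P {ω | totalSum ζ ω ≠ ∞} * a ^ 2) := by gcongr
    _ = _ := by ring

end Infinite

end ColouredTree

theorem theorem1 {b : ℕ} (hb : 2 ≤ b)
    {Ω₀ : Type*} [MeasurableSpace Ω₀] (P₀ : Measure Ω₀) [IsProbabilityMeasure P₀]
    (ξ : Fin b → Fin b → Ω₀ → ℝ) (hξ_meas : ∀ i j, Measurable (ξ i j))
    (hξ_pos : ∀ i j, ∀ᵐ ω ∂P₀, 0 < ξ i j ω)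
    {Ω : Type*} [MeasurableSpace Ω] (P : Measure Ω) [IsProbabilityMeasure P]
    (c : Ω → ColouredTree.Vertex b → Fin b) (hc : ColouredTree.IsUniformColouring P c)
    (ζ : ColouredTree.Vertex b → Fin b → Ω → ℝ)
    (hζ : ColouredTree.IsEnvironment P₀ ξ P c ζ) :
    (ColouredTree.lambdaOne P₀ ξ < 1 →
      ∀ᵐ ω ∂P, ColouredTree.totalSum ζ ω < ∞) ∧
    (1 < ColouredTree.lambdaOne P₀ ξ → ColouredTree.IsRegular P₀ ξ →
      ∀ᵐ ω ∂P, ColouredTree.totalSum ζ ω = ∞) := by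
  have : NeZero b := ⟨by omega⟩
  exact ⟨fun h => ColouredTree.ae_totalSum_lt_top hξ_meas hξ_pos hc.measurable hc.proper hζ h,
    fun h hreg => ColouredTree.ae_totalSum_eq_top hb hξ_meas hξ_pos hreg.Icc_subset
      hc.measurable hc.proper hζ h⟩
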